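/- **Signature and terms.** Let $\mathcal F=\mathcal F_n\uplus\mathcal F_r$ and $\mathcal G=\mathcal G_n\uplus\mathcal G_r$ be arbitrary disjoint sets of connectives (*normal* ones in $\mathcal F_n,\mathcal G_n$, *regular* ones in $\mathcal F_r,\mathcal G_r$). Each connective $h$ has a finite arity $n_h\ge 0$ and an order-type $\varepsilon_h\in\{1,\partial\}^{n_h}$; regular connectives are unary. $\mathcal L_{\mathrm{LE}}$-terms are built from a denumerable set of proposition variables by $\bot,\top,\wedge,\vee$ and the connectives. **Lattice expansions.** A *lattice expansion* (LE) $\mathbb A$ is a bounded lattice $L$ with an operation $h^{\mathbb A}:L^{n_h}\to L$ for each connective $h$, such that in each coordinate $i$: if $f\in\mathcal F$, then $f$ preserves binary joins when $\varepsilon_f(i)=1$ and sends binary meets to joins when $\varepsilon_f(i)=\partial$; if $g\in\mathcal G$, then $g$ preserves binary meets when $\varepsilon_g(i)=1$ and sends binary joins to meets when $\varepsilon_g(i)=\partial$; and normal connectives do the same for empty joins and meets. An inequality $s\le t$ is *valid* in an algebra, $\mathbb A\models s\le t$, if it holds under all assignments of elements to the variables. **Constructive canonical extension.** Let $L^\delta$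 be the complete lattice of Galois-stable sets of the polarity $(\mathbf F,\mathbf I,\le)$, where $\mathbf F$, $\mathbf I$ are the sets of all filters and all ideals of $L$ and $F\le I$ iff $F\cap I\neq\varnothing$. It is formed without any choice principle. $L$ is embedded in it by sending $a$ to the stable set generated by the principal filter $a{\uparrow}$. *Closed* (*open*) elements of $L^\delta$ are the meets (joins) of subsets of $L$. Write $\le^{1}$ for $\le$ and $\le^{\partial}$ for $\ge$, and, for tuples, $u\le^\varepsilon v$ iff $u_i\le^{\varepsilon(i)}v_i$ for all $i$. A tuple $k$ in $L^\delta$ is *$\varepsilon$-closed* if $k_i$ is closed when $\varepsilon(i)=1$ and open when $\varepsilon(i)=\partial$; *$\varepsilon$-open* is defined with closed and open interchanged. Then $\mathbb A^\delta$ is $L^\delta$ with, for $f\in\mathcal F$ and $g\in\mathcal G$, $$f^{\mathbb A^\delta}(u)=\bigvee\Big\{\bigwedge\{f(a)\mid a\in L^{n_f},\,k\le^{\varepsilon_f}a\}\;\Big|\;k\ \varepsilon_f\text{-closed},\ k\le^{\varepsilon_f}u\Big\},$$ $$g^{\mathbb A^\delta}(u)=\bigwedge\Big\{\bigvee\{g(a)\mid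 a\in L^{n_g},\,a\le^{\varepsilon_g}o\}\;\Big|\;o\ \varepsilon_g\text{-open},\ u\le^{\varepsilon_g}o\Big\}.$$ **Inductive inequalities.** The signed generation tree $+s$ (resp. $-s$) of a term $s$ is its generation tree with the root signed $+$ (resp. $-$); $\wedge,\vee$ pass their sign to their children, and a connective $h$ passes its own sign to its $i$-th child if $\varepsilon_h(i)=1$ and the opposite sign if $\varepsilon_h(i)=\partial$. *Skeleton* nodes are $+\vee$, $-\wedge$, $+f$, $-g$ ($f\in\mathcal F$, $g\in\mathcal G$). *PIA* nodes are $+\wedge$, $-\vee$, unary $+g$, unary $-f$, and the *SRR* nodes, which are $+g$ with $g\in\mathcal G_n$, $n_g\ge 2$ and $-f$ with $f\in\mathcal F_n$, $n_f\ge2$. Let $\epsilon$ assign $1$ or $\partial$ to each variable. A variable leaf is *$\epsilon$-critical* if it is $+p$ with $\epsilon(p)=1$ or $-p$ with $\epsilon(p)=\partial$; a branch is $\epsilon$-critical if its leaf is. A branch is *good* if, read from the root and apart from the leaf, it consists of Skeleton nodes followed by PIA nodes (either part may be empty). For an irreflexive and transitive relation $<_\Omega$ on the variables, a signed generation tree is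 *$(\Omega,\epsilon)$-inductive* if every $\epsilon$-critical branch, with leaf $p$ say, is good and, for each SRR node on it and each child $\gamma$ of that node that is not on the branch, no variable leaf of $\gamma$ (with the inherited signs) is $\epsilon$-critical and every variable $q$ occurring in $\gamma$ satisfies $q<_\Omega p$. The inequality $s\le t$ is *inductive* if, for some $\Omega$ and $\epsilon$, both $+s$ and $-t$ are $(\Omega,\epsilon)$-inductive. **Theorem.** For every such signature, every inductive $\mathcal L_{\mathrm{LE}}$-inequality $s\le t$ is constructively canonical: for every lattice expansion $\mathbb A$, if $\mathbb A\models s\le t$ then $\mathbb A^\delta\models s\le t$. -/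

import Mathlib

universe u v w

namespace LatExp

/-- The two values `1` (here `pos`) and `∂` (here `neg`) of an order-type. They also serve as
the signs `+` and `-` of the nodes of a signed generation tree. -/
inductive Sgn : Type
  | pos : Sgn
  | neg : Sgn

/-- The opposite value. -/
def Sgn.opp : Sgn → Sgn
  | .pos => .neg
  | .neg => .pos

/-- `σ.mul ε` is `σ` if `ε = 1` and the opposite of `σ` if `ε = ∂`. -/
def Sgn.mul (σ : Sgn) : Sgn → Sgn
  | .pos => σ
  | .neg => σ.opp

/-! ### Language -/

/-- The parameters `(𝓕, 𝓖)` of the language: two (disjoint) families of connectives with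
arities and order-types. `𝓕` splits into the regular connectives (those with `regF`) and the
normal ones (the others), and so does `𝓖`; regular connectives are unary. -/
structure Signature where
  F : Type u
  G : Type v
  arF : F → ℕ
  arG : G → ℕ
  epsF : (f : F) → Fin (arF f) → Sgn
  epsG : (g : G) → Fin (arG g) → Sgn
  regF : F → Prop
  regG : G → Prop
  regF_unary : ∀ f, regF f → arF f = 1
  regG_unary : ∀ g, regG g → arG g = 1

/-- Terms of the language; the denumerable set of proposition letters is `ℕ`. -/
inductive Term (S : Signature.{u, v}) : Type (max u v)
  | var : ℕ → Term S
  | bot : Term S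
  | top : Term S
  | and : Term S → Term S → Term S
  | or : Term S → Term S → Term S
  | fapp : (f : S.F) → (Fin (S.arF f) → Term S) → Term S
  | gapp : (g : S.G) → (Fin (S.arG g) → Term S) → Term S

/-! ### Lattice expansions and validity -/

/-- An interpretation of the connectives of the signature as operations on `L`. -/
structure Ops (S : Signature.{u, v}) (L : Type w) where
  opF : (f : S.F) → (Fin (S.arF f) → L) → L
  opG : (g : S.G) → (Fin (S.arG g) → L) → L

namespace Ops

variable {S : Signature.{u, v}} {L : Type w} [Lattice L] [BoundedOrder L]

/-- The bounded lattice `L` with the operations `A` is a lattice expansion: normal operations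
preserve (or reverse) all finite joins or meets in each coordinate, regular ones preserve (or
reverse) the finite nonempty ones. -/
structure IsLatticeExpansion (A : Ops S L) : Prop where
  f_pos : ∀ (f : S.F) (x : Fin (S.arF f) → L) (i : Fin (S.arF f)) (a b : L),
    S.epsF f i = Sgn.pos →
      A.opF f (Function.update x i (a ⊔ b)) =
        A.opF f (Function.update x i a) ⊔ A.opF f (Function.update x i b)
  f_neg : ∀ (f : S.F) (x : Fin (S.arF f) → L) (i : Fin (S.arF f)) (a b : L),
    S.epsF f i = Sgn.neg →
      A.opF f (Function.update x i (a ⊓ b)) =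
        A.opF f (Function.update x i a) ⊔ A.opF f (Function.update x i b)
  g_pos : ∀ (g : S.G) (x : Fin (S.arG g) → L) (i : Fin (S.arG g)) (a b : L),
    S.epsG g i = Sgn.pos →
      A.opG g (Function.update x i (a ⊓ b)) =
        A.opG g (Function.update x i a) ⊓ A.opG g (Function.update x i b)
  g_neg : ∀ (g : S.G) (x : Fin (S.arG g) → L) (i : Fin (S.arG g)) (a b : L),
    S.epsG g i = Sgn.neg →
      A.opG g (Function.update x i (a ⊔ b)) =
        A.opG g (Function.update x i a) ⊓ A.opG g (Function.update x i b)
  f_pos_normal : ∀ (f : S.F) (x : Fin (S.arF f) → L) (i : Fin (S.arF f)),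
    ¬ S.regF f → S.epsF f i = Sgn.pos → A.opF f (Function.update x i ⊥) = ⊥
  f_neg_normal : ∀ (f : S.F) (x : Fin (S.arF f) → L) (i : Fin (S.arF f)),
    ¬ S.regF f → S.epsF f i = Sgn.neg → A.opF f (Function.update x i ⊤) = ⊥
  g_pos_normal : ∀ (g : S.G) (x : Fin (S.arG g) → L) (i : Fin (S.arG g)),
    ¬ S.regG g → S.epsG g i = Sgn.pos → A.opG g (Function.update x i ⊤) = ⊤
  g_neg_normal : ∀ (g : S.G) (x : Fin (S.arG g) → L) (i : Fin (S.arG g)),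
    ¬ S.regG g → S.epsG g i = Sgn.neg → A.opG g (Function.update x i ⊥) = ⊤

/-- The value of a term under an assignment, that is, the homomorphism from the algebra of
formulas that extends the assignment. -/
def eval (A : Ops S L) (h : ℕ → L) : Term S → L
  | .var p => h p
  | .bot => ⊥
  | .top => ⊤
  | .and s t => A.eval h s ⊓ A.eval h t
  | .or s t => A.eval h s ⊔ A.eval h t
  | .fapp f args => A.opF f (fun i => A.eval h (args i))
  | .gapp g args => A.opG g (fun i => A.eval h (args i))

/-- Validity of the inequality `s ≤ t`. -/
def Valid (A : Ops S L) (s t : Term S) : Prop :=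
  ∀ h : ℕ → L, A.eval h s ≤ A.eval h t

end Ops

/-! ### The constructive canonical extension -/

section CanonicalExtension

variable (L : Type w) [Lattice L]

/-- The relation `F ≤ I` of the polarity of filters and ideals: `F ∩ I` is nonempty. -/
def meets (F : Order.PFilter L) (I : Order.Ideal L) : Prop :=
  ∃ a : L, a ∈ F ∧ a ∈ I

/-- The canonical extension of a lattice: the complete lattice of the Galois-stable sets of the
polarity of all filters and all ideals. (A `Concept` is a stable set of filters, paired with the
stable set of ideals that corresponds to it; the order is inclusion of the sets of filters.) -/
abbrev CanExt : Type w :=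
  Concept (Order.PFilter L) (Order.Ideal L) (meets L)

variable {L}

/-- The canonical embedding: `a` goes to the stable set generated by the principal filter of `a`. -/
def embed (a : L) : CanExt L :=
  Concept.ofObject (meets L) (Order.PFilter.principal a)

/-- Closed elements: meets of elements of `L`. -/
def IsClosedElt (u : CanExt L) : Prop :=
  ∃ X : Set L, u = sInf (embed '' X)

/-- Open elements: joins of elements of `L`. -/
def IsOpenElt (u : CanExt L) : Prop :=
  ∃ X : Set L, u = sSup (embed '' X)

/-- `u ≤^ε v`, in one coordinate. -/
def leSgn : Sgn → CanExt L → CanExt L → Prop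
  | .pos, u, v => u ≤ v
  | .neg, u, v => v ≤ u

/-- Closed elements of the `ε`-th (order-dual) copy of the canonical extension. -/
def IsClosedSgn : Sgn → CanExt L → Prop
  | .pos, u => IsClosedElt u
  | .neg, u => IsOpenElt u

/-- Open elements of the `ε`-th (order-dual) copy of the canonical extension. -/
def IsOpenSgn : Sgn → CanExt L → Prop
  | .pos, u => IsOpenElt u
  | .neg, u => IsClosedElt u

variable {n : ℕ}

/-- The first clause of the `σ`-extension, to be used on `ε`-closed tuples `k`:
`⋀ {h(a) | a ∈ L^n, k ≤^ε a}`. -/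
def sigmaClosed (ε : Fin n → Sgn) (h : (Fin n → L) → L) (k : Fin n → CanExt L) : CanExt L :=
  sInf {x | ∃ a : Fin n → L, (∀ i, leSgn (ε i) (k i) (embed (a i))) ∧ x = embed (h a)}

/-- The `σ`-extension of an `ε`-monotone operation. -/
def sigmaExt (ε : Fin n → Sgn) (h : (Fin n → L) → L) (x : Fin n → CanExt L) : CanExt L :=
  sSup {y | ∃ k : Fin n → CanExt L,
    (∀ i, IsClosedSgn (ε i) (k i)) ∧ (∀ i, leSgn (ε i) (k i) (x i)) ∧ y = sigmaClosed ε h k}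

/-- The first clause of the `π`-extension, to be used on `ε`-open tuples `o`:
`⋁ {h(a) | a ∈ L^n, a ≤^ε o}`. -/
def piOpen (ε : Fin n → Sgn) (h : (Fin n → L) → L) (o : Fin n → CanExt L) : CanExt L :=
  sSup {x | ∃ a : Fin n → L, (∀ i, leSgn (ε i) (embed (a i)) (o i)) ∧ x = embed (h a)}

/-- The `π`-extension of an `ε`-monotone operation. -/
def piExt (ε : Fin n → Sgn) (h : (Fin n → L) → L) (x : Fin n → CanExt L) : CanExt L :=
  sInf {y | ∃ o : Fin n → CanExt L,
    (∀ i, IsOpenSgn (ε i) (o i)) ∧ (∀ i, leSgn (ε i) (x i) (o i)) ∧ y = piOpen ε h o}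

/-- The operations of the canonical extension of a lattice expansion: `σ`-extensions for the
connectives in `𝓕` and `π`-extensions for those in `𝓖`. -/
def Ops.canExt {S : Signature.{u, v}} (A : Ops S L) : Ops S (CanExt L) where
  opF f := sigmaExt (S.epsF f) (A.opF f)
  opG g := piExt (S.epsG g) (A.opG g)

end CanonicalExtension

/-! ### Signed generation trees -/

section Inductive

variable {S : Signature.{u, v}}

/-- Number of children of the root of the generation tree. -/
def Term.arity : Term S → ℕ
  | .var _ => 0
  | .bot => 0
  | .top => 0
  | .and _ _ => 2
  | .or _ _ => 2
  | .fapp f _ => S.arF f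
  | .gapp g _ => S.arG g

/-- The immediate subterms. -/
def Term.child : (t : Term S) → Fin t.arity → Term S
  | .and s t => ![s, t]
  | .or s t => ![s, t]
  | .fapp _ args => args
  | .gapp _ args => args
  | .var _ => Fin.elim0
  | .bot => Fin.elim0
  | .top => Fin.elim0

/-- The order-type of the root connective. -/
def Term.rootType : (t : Term S) → Fin t.arity → Sgn
  | .and _ _ => fun _ => .pos
  | .or _ _ => fun _ => .pos
  | .fapp f _ => S.epsF f
  | .gapp g _ => S.epsG g
  | .var _ => Fin.elim0
  | .bot => Fin.elim0
  | .top => Fin.elim0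

/-- The sign of the `i`-th child of a node with sign `σ`. -/
def childSign (σ : Sgn) (t : Term S) (i : Fin t.arity) : Sgn :=
  σ.mul (t.rootType i)

/-- The proposition letters that occur in a term. -/
def Term.vars : Term S → Set ℕ
  | .var p => {p}
  | .bot => ∅
  | .top => ∅
  | .and s t => s.vars ∪ t.vars
  | .or s t => s.vars ∪ t.vars
  | .fapp _ args => ⋃ i, (args i).vars
  | .gapp _ args => ⋃ i, (args i).vars

/-- The branches of the signed generation tree of `t` with root sign `σ` that end in a
propositional variable. A branch starts at the root and records which child is taken. -/
inductive Branch : Sgn → Term S → Type (max u v)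
  | leaf (σ : Sgn) (p : ℕ) : Branch σ (.var p)
  | step (σ : Sgn) (t : Term S) (i : Fin t.arity)
      (b : Branch (childSign σ t i) (t.child i)) : Branch σ t

/-- An inner node of a branch: its sign, the subterm at it, and the child that is taken. -/
structure BranchNode (S : Signature.{u, v}) where
  sign : Sgn
  term : Term S
  idx : Fin term.arity

/-- The inner (non-variable) nodes of a branch, from the root towards the leaf. -/
def Branch.nodes {σ : Sgn} {t : Term S} : Branch σ t → List (BranchNode S)
  | .leaf _ _ => []
  | .step σ t i b => ⟨σ, t, i⟩ :: b.nodes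

/-- The variable at the leaf. -/
def Branch.leafVar {σ : Sgn} {t : Term S} : Branch σ t → ℕ
  | .leaf _ p => p
  | .step _ _ _ b => b.leafVar

/-- The sign of the leaf. -/
def Branch.leafSign {σ : Sgn} {t : Term S} : Branch σ t → Sgn
  | .leaf σ _ => σ
  | .step _ _ _ b => b.leafSign

/-! The classification of signed nodes. -/

/-- `Δ`-adjoints: `+∨` and `-∧`. -/
def IsDeltaAdjoint : Sgn → Term S → Prop
  | .pos, .or _ _ => True
  | .neg, .and _ _ => True
  | _, _ => False

/-- Syntactically additive coordinatewise nodes: `+f` and `-g`. -/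
def IsSAC : Sgn → Term S → Prop
  | .pos, .fapp _ _ => True
  | .neg, .gapp _ _ => True
  | _, _ => False

/-- Syntactically multiplicative in the product: `+∧`, `-∨`, unary `+g`, unary `-f`. -/
def IsSMP : Sgn → Term S → Prop
  | .pos, .and _ _ => True
  | .neg, .or _ _ => True
  | .pos, .gapp g _ => S.arG g = 1
  | .neg, .fapp f _ => S.arF f = 1
  | _, _ => False

/-- Syntactically right residual: normal `+g` and `-f` of arity at least two. -/
def IsSRR : Sgn → Term S → Prop
  | .pos, .gapp g _ => ¬ S.regG g ∧ 2 ≤ S.arG g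
  | .neg, .fapp f _ => ¬ S.regF f ∧ 2 ≤ S.arF f
  | _, _ => False

/-- Skeleton nodes. -/
def IsSkeleton (σ : Sgn) (t : Term S) : Prop := IsDeltaAdjoint σ t ∨ IsSAC σ t

/-- PIA nodes. -/
def IsPIA (σ : Sgn) (t : Term S) : Prop := IsSMP σ t ∨ IsSRR σ t

/-- A branch is good if, from the root, it consists of Skeleton nodes followed by PIA nodes
(either part may be empty). -/
def Branch.Good {σ : Sgn} {t : Term S} (b : Branch σ t) : Prop :=
  ∃ P₂ P₁ : List (BranchNode S), b.nodes = P₂ ++ P₁ ∧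
    (∀ N ∈ P₂, IsSkeleton N.sign N.term) ∧ (∀ N ∈ P₁, IsPIA N.sign N.term)

/-- A branch is `ε`-critical if its leaf is `+p` with `ε p = 1` or `-p` with `ε p = ∂`. -/
def Branch.Critical {σ : Sgn} {t : Term S} (ε : ℕ → Sgn) (b : Branch σ t) : Prop :=
  b.leafSign = ε b.leafVar

/-- The signed generation tree of `t` with root sign `σ` agrees with `ε`: all its variable leaves
are `ε`-critical. -/
def Agrees (ε : ℕ → Sgn) (σ : Sgn) (t : Term S) : Prop :=
  ∀ b : Branch σ t, b.Critical ε

/-- The signed generation tree of `t` with root sign `σ` is `(Ω, ε)`-inductive. -/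
def IsInductiveTree (Ω : ℕ → ℕ → Prop) (ε : ℕ → Sgn) (σ : Sgn) (t : Term S) : Prop :=
  ∀ b : Branch σ t, b.Critical ε →
    b.Good ∧
    ∀ N ∈ b.nodes, IsSRR N.sign N.term → ∀ h : Fin N.term.arity, h ≠ N.idx →
      Agrees (fun p => (ε p).opp) (childSign N.sign N.term h) (N.term.child h) ∧
      ∀ k ∈ (N.term.child h).vars, Ω k b.leafVar

/-- The inequality `s ≤ t` is inductive: for some order-type `ε` and some irreflexive and
transitive relation `Ω` on the variables, `+s` and `-t` are `(Ω, ε)`-inductive. -/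
def IsInductive (s t : Term S) : Prop :=
  ∃ (Ω : ℕ → ℕ → Prop) (ε : ℕ → Sgn),
    (∀ p, ¬ Ω p p) ∧ (∀ p q r, Ω p q → Ω q r → Ω p r) ∧
      IsInductiveTree Ω ε .pos s ∧ IsInductiveTree Ω ε .neg t

end Inductive

/-- The inequality `s ≤ t` is constructively canonical (for algebras in the universe `w`): its
validity transfers from every lattice expansion to its canonical extension. -/
def ConstructivelyCanonical {S : Signature.{u, v}} (s t : Term S) : Prop :=
  ∀ (L : Type w) [Lattice L] [BoundedOrder L] (A : Ops S L),
    A.IsLatticeExpansion → A.Valid s t → A.canExt.Valid s t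

end LatExp

/-!
The canonicity of inductive inequalities is proved directly, without a calculus for eliminating
variables. Both signs are treated at once: `SLe σ` is `≤` or `≥`, and `sElt σ P` is the closed
element of a filter `P` or the open element of an ideal `P`.

Let `x` be a valuation in the canonical extension of `A`, and let `s ≤ t` be inductive and valid in
`A`. By density it is enough to compare closed elements below `s(x)` with open elements above
`t(x)`. Every connective is handled through `IsExt`, which says when a value of the extended
operation lies below an open element, in terms of closed elements below the arguments. It follows
that the extended operations preserve nonempty joins in each coordinate (`IsExt.le_of_dense`), so
that along the Skeleton part of a term the arguments can be replaced by closed elements `k` below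
the PIA subterms.

An inequality `k ≤ γ(x)` with a PIA subterm `γ` is moved by residuation along the critical branches
of `γ` (`eventually_eval_mem`). The outcome is a finite set of demands (`Demand`) of two kinds: lower
bounds for the value of a variable `p`, which depend only on variables `q <_Ω p`, and conditions on
uncritical subterms, which hold near every closed valuation below `x` by the intersection lemma
`sElt_limEval_le`. The bounds are filters of elements of `L` that depend on a valuation in `L`, and a
valuation in `L` that meets the demands also satisfies `k ≤ γ`. Since a connective
need not be normal, the demand that the bound is met at the least value of the argument is added
(`Demand.evalUpdate_sTop`).

Finitely many demands are always met by a valuation in `L` (`exists_valuation`). The minimal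
valuation that satisfies the lower bounds is defined by recursion upwards along `Ω` (`MinVal`). It is
closed and lies below `x`, so the conditions of the second kind hold near it, and an approximation
in `L` that respects the lower bounds can be chosen downwards along `Ω`. Hence the demands generate a
proper filter of valuations in `L` (`demandFilter_neBot`). At a valuation `h` that meets the demands
from both sides, `s(h) ≤ t(h)` gives an element of `L` between the closed and the open element.
-/

namespace LatExp

/-! ### Signed order -/

@[simp] theorem Sgn.opp_opp (σ : Sgn) : σ.opp.opp = σ := by cases σ <;> rfl

theorem Sgn.eq_or_eq_opp (σ τ : Sgn) : σ = τ ∨ σ = τ.opp := by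
  cases σ <;> cases τ <;> simp [Sgn.opp]

theorem Sgn.eq_opp_iff {σ τ : Sgn} : σ = τ.opp ↔ σ ≠ τ := by
  cases σ <;> cases τ <;> simp [Sgn.opp]

section SignedOrder

/-- The order `≤` for the sign `1` and its converse for the sign `∂`. -/
def SLe {M : Type*} [LE M] : Sgn → M → M → Prop
  | .pos, a, b => a ≤ b
  | .neg, a, b => b ≤ a

/-- The binary meet of the order `SLe σ`. The join of that order is `smeet σ.opp`. -/
def smeet {M : Type*} [Lattice M] : Sgn → M → M → M
  | .pos, a, b => a ⊓ b
  | .neg, a, b => a ⊔ b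

/-- The greatest element of the order `SLe σ`. The least one is `sTop σ.opp`. -/
def sTop {M : Type*} [LE M] [BoundedOrder M] : Sgn → M
  | .pos => ⊤
  | .neg => ⊥

theorem sLe_opp {M : Type*} [LE M] {σ : Sgn} {a b : M} : SLe σ.opp a b ↔ SLe σ b a := by
  cases σ <;> rfl

theorem leSgn_iff {L : Type w} [Lattice L] {σ : Sgn} {x y : CanExt L} :
    leSgn σ x y ↔ SLe σ x y := by
  cases σ <;> rfl

variable {M : Type*} [Lattice M] {σ : Sgn} {a b c : M}

theorem SLe.refl (σ : Sgn) (a : M) : SLe σ a a := by cases σ <;> exact le_rfl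

theorem SLe.trans (h : SLe σ a b) (h' : SLe σ b c) : SLe σ a c := by
  cases σ
  exacts [le_trans (α := M) h h', le_trans (α := M) h' h]

theorem SLe.antisymm (h : SLe σ a b) (h' : SLe σ b a) : a = b := by
  cases σ
  exacts [le_antisymm h h', le_antisymm h' h]

theorem smeet_le_left (σ : Sgn) (a b : M) : SLe σ (smeet σ a b) a := by
  cases σ
  exacts [inf_le_left, le_sup_left]

theorem smeet_le_right (σ : Sgn) (a b : M) : SLe σ (smeet σ a b) b := by
  cases σ
  exacts [inf_le_right, le_sup_right]

theorem le_smeet (h : SLe σ a b) (h' : SLe σ a c) : SLe σ a (smeet σ b c) := by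
  cases σ
  exacts [le_inf (α := M) h h', sup_le (α := M) h h']

theorem sLe_sTop [BoundedOrder M] (σ : Sgn) (a : M) : SLe σ a (sTop σ) := by
  cases σ
  exacts [le_top, bot_le]

theorem sTop_smeet [BoundedOrder M] (σ : Sgn) (a : M) : smeet σ (sTop σ) a = a :=
  (smeet_le_right _ _ _).antisymm (le_smeet (sLe_sTop _ _) (.refl _ _))

theorem smeet_sTop [BoundedOrder M] (σ : Sgn) (a : M) : smeet σ a (sTop σ) = a :=
  (smeet_le_left _ _ _).antisymm (le_smeet (.refl _ _) (sLe_sTop _ _))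

end SignedOrder

section SignedFilter

variable {L : Type w} [Lattice L] [BoundedOrder L]

/-- Filters of the order `SLe σ`: filters for the sign `1`, ideals for the sign `∂`. -/
structure IsSFilter (σ : Sgn) (P : Set L) : Prop where
  top_mem : sTop σ ∈ P
  smeet_mem : ∀ {a b}, a ∈ P → b ∈ P → smeet σ a b ∈ P
  mem_of_le : ∀ {a b}, SLe σ a b → a ∈ P → b ∈ P

theorem isSFilter_univ (σ : Sgn) : IsSFilter σ (Set.univ : Set L) :=
  ⟨trivial, fun _ _ => trivial, fun _ _ => trivial⟩

theorem isSFilter_Ici (σ : Sgn) (a : L) : IsSFilter σ {b | SLe σ a b} :=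
  ⟨sLe_sTop _ _, le_smeet, fun h h' => SLe.trans h' h⟩

/-- Finitely many requirements on an element of a signed filter can be met together if each can be
met and they are all inherited by smaller elements. -/
theorem IsSFilter.exists_forall_mem {σ : Sgn} {P : Set L} (hP : IsSFilter σ P) {ι : Type*}
    [Finite ι] (φ : ι → L → Prop) (hφ : ∀ i a b, SLe σ a b → φ i b → φ i a)
    (h : ∀ i, ∃ a ∈ P, φ i a) : ∃ a ∈ P, ∀ i, φ i a := by
  have key : ∀ s : Set ι, s.Finite → ∃ a ∈ P, ∀ i ∈ s, φ i a := by
    intro s hs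
    induction s, hs using Set.Finite.induction_on with
    | empty => exact ⟨_, hP.top_mem, by simp⟩
    | @insert i s _ _ ih =>
      obtain ⟨a, ha, ha'⟩ := ih
      obtain ⟨b, hb, hb'⟩ := h i
      refine ⟨smeet σ a b, hP.smeet_mem ha hb, ?_⟩
      rintro j (rfl | hj)
      exacts [hφ _ _ _ (smeet_le_right _ _ _) hb', hφ _ _ _ (smeet_le_left _ _ _) (ha' j hj)]
  simpa using key Set.univ Set.finite_univ

end SignedFilter

/-! ### Closed and open elements of the canonical extension -/

section CanExt

variable {L : Type w} [Lattice L]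

theorem embed_eq_ofAttribute (a : L) :
    embed a = Concept.ofAttribute (meets L) (Order.Ideal.principal a) := by
  refine le_antisymm (Concept.ofObject_le_ofAttribute_iff.2 ⟨a, by simp, by simp⟩) ?_
  rw [← Concept.extent_subset_extent_iff]
  rintro G hG I hI
  obtain ⟨b, hb, hb'⟩ := hG (Set.mem_singleton _)
  obtain ⟨c, hc, hc'⟩ := hI (Set.mem_singleton _)
  exact ⟨b, hb, I.lower (le_trans (by simpa using hb') (Order.PFilter.mem_principal.1 hc)) hc'⟩

theorem ofObject_le_embed {F : Order.PFilter L} {a : L} :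
    Concept.ofObject (meets L) F ≤ embed a ↔ a ∈ F := by
  rw [embed_eq_ofAttribute, Concept.ofObject_le_ofAttribute_iff]
  exact ⟨fun ⟨b, hb, hb'⟩ => Order.PFilter.mem_of_le (by simpa using hb') hb,
    fun h => ⟨a, h, by simp⟩⟩

theorem embed_le_ofAttribute {I : Order.Ideal L} {a : L} :
    embed a ≤ Concept.ofAttribute (meets L) I ↔ a ∈ I := by
  rw [embed, Concept.ofObject_le_ofAttribute_iff]
  exact ⟨fun ⟨b, hb, hb'⟩ => I.lower (by simpa using hb) hb', fun h => ⟨a, by simp, h⟩⟩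

theorem sInf_embed (F : Order.PFilter L) :
    sInf (embed '' (F : Set L)) = Concept.ofObject (meets L) F := by
  refine le_antisymm ?_ (le_sInf ?_)
  · rw [← Concept.extent_subset_extent_iff]
    rintro G hG I hI
    obtain ⟨a, ha, ha'⟩ := hI (Set.mem_singleton _)
    have h1 : Concept.ofObject (meets L) G ≤ sInf (embed '' (F : Set L)) := by
      simpa using hG
    exact ⟨a, ofObject_le_embed.1 (h1.trans (sInf_le ⟨a, ha, rfl⟩)), ha'⟩
  · rintro _ ⟨a, ha, rfl⟩
    exact ofObject_le_embed.2 ha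

theorem sSup_embed (I : Order.Ideal L) :
    sSup (embed '' (I : Set L)) = Concept.ofAttribute (meets L) I := by
  refine le_antisymm (sSup_le ?_) ?_
  · rintro _ ⟨a, ha, rfl⟩
    exact embed_le_ofAttribute.2 ha
  · rw [← Concept.intent_subset_intent_iff]
    rintro J hJ F hF
    obtain ⟨a, ha, ha'⟩ := hF (Set.mem_singleton _)
    have h1 : sSup (embed '' (I : Set L)) ≤ Concept.ofAttribute (meets L) J := by
      simpa using hJ
    exact ⟨a, ha, embed_le_ofAttribute.1 ((le_sSup (Set.mem_image_of_mem _ ha')).trans h1)⟩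

/-- The `σ`-meet of the image of `P` in the canonical extension: for signed filters `P`, these are
the closed elements (for the sign `1`) and the open elements (for the sign `∂`). -/
def sElt : Sgn → Set L → CanExt L
  | .pos, P => sInf (embed '' P)
  | .neg, P => sSup (embed '' P)

theorem sElt_le_embed (σ : Sgn) {P : Set L} {a : L} (ha : a ∈ P) : SLe σ (sElt σ P) (embed a) := by
  cases σ
  exacts [sInf_le ⟨a, ha, rfl⟩, le_sSup ⟨a, ha, rfl⟩]

theorem le_sElt {σ : Sgn} {P : Set L} {x : CanExt L} (h : ∀ a ∈ P, SLe σ x (embed a)) :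
    SLe σ x (sElt σ P) := by
  cases σ
  · exact le_sInf (by rintro _ ⟨a, ha, rfl⟩; exact h a ha)
  · exact sSup_le (by rintro _ ⟨a, ha, rfl⟩; exact h a ha)

theorem embed_mono {σ : Sgn} {a b : L} (h : SLe σ a b) : SLe σ (embed a) (embed b) := by
  have key : ∀ {a b : L}, a ≤ b → embed a ≤ embed b := fun {a b} hab =>
    Concept.ofObjects_le_iff.2 (by
      simpa using (ofObject_le_embed (F := Order.PFilter.principal a)).2 hab)
  cases σ <;> exact key h

theorem isClosedSgn_sElt (σ : Sgn) (P : Set L) : IsClosedSgn σ (sElt σ P) := by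
  cases σ <;> exact ⟨P, rfl⟩

theorem sElt_opp_Ici (σ : Sgn) (a : L) : sElt σ.opp {b | SLe σ.opp a b} = embed a :=
  (sElt_le_embed σ.opp (.refl _ _)).antisymm (le_sElt fun _ hb => embed_mono hb)

variable [BoundedOrder L] {σ : Sgn} {P Q : Set L}

theorem IsSFilter.exists_ofObject (hP : IsSFilter .pos P) :
    ∃ F : Order.PFilter L, (F : Set L) = P ∧ sElt .pos P = Concept.ofObject (meets L) F := by
  have : Order.IsPFilter P := .of_def ⟨_, hP.top_mem⟩
    (fun a ha b hb => ⟨_, hP.smeet_mem ha hb, smeet_le_left .pos a b, smeet_le_right .pos a b⟩)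
    (fun h => hP.mem_of_le h)
  refine ⟨this.toPFilter, rfl, sInf_embed this.toPFilter⟩

theorem IsSFilter.exists_ofAttribute (hP : IsSFilter .neg P) :
    ∃ I : Order.Ideal L, (I : Set L) = P ∧ sElt .neg P = Concept.ofAttribute (meets L) I := by
  have : Order.IsIdeal P :=
    { IsLowerSet := fun a b h ha => hP.mem_of_le (a := a) (b := b) h ha
      Nonempty := ⟨_, hP.top_mem⟩
      Directed := fun a ha b hb =>
        ⟨_, hP.smeet_mem ha hb, smeet_le_left .neg a b, smeet_le_right .neg a b⟩ }
  refine ⟨this.toIdeal, rfl, sSup_embed this.toIdeal⟩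

/-- Compactness of the canonical extension. -/
theorem sElt_le_sElt_opp (hP : IsSFilter σ P) (hQ : IsSFilter σ.opp Q) :
    SLe σ (sElt σ P) (sElt σ.opp Q) ↔ ∃ a ∈ P, a ∈ Q := by
  have key : ∀ {P Q : Set L}, IsSFilter .pos P → IsSFilter .neg Q →
      (sElt .pos P ≤ sElt .neg Q ↔ ∃ a ∈ P, a ∈ Q) := by
    intro P Q hP hQ
    obtain ⟨F, rfl, hF⟩ := hP.exists_ofObject
    obtain ⟨I, rfl, hI⟩ := hQ.exists_ofAttribute
    rw [hF, hI, Concept.ofObject_le_ofAttribute_iff]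
    rfl
  cases σ
  · exact key hP hQ
  · exact (key hQ hP).trans (exists_congr fun _ => and_comm)

/-- Density: the order is determined by the `σ`-upper bounds of the form `sElt σ.opp Q`. -/
theorem sLe_of_forall_le_sElt {x y : CanExt L}
    (h : ∀ Q, IsSFilter σ.opp Q → SLe σ y (sElt σ.opp Q) → SLe σ x (sElt σ.opp Q)) :
    SLe σ x y := by
  cases σ
  · change x ≤ y
    rw [← Concept.intent_subset_intent_iff]
    intro I hI
    have := h I ⟨I.bot_mem, fun ha hb => I.sup_mem ha hb, fun hab ha => I.lower hab ha⟩
    change y ≤ sSup (embed '' (I : Set L)) → x ≤ sSup (embed '' (I : Set L)) at this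
    rw [sSup_embed] at this
    simpa using this (by simpa using hI)
  · change y ≤ x
    rw [← Concept.extent_subset_extent_iff]
    intro F hF
    have := h F ⟨F.top_mem, fun ha hb => F.inf_mem ha hb, fun hab ha => F.mem_of_le hab ha⟩
    change sInf (embed '' (F : Set L)) ≤ y → sInf (embed '' (F : Set L)) ≤ x at this
    rw [sInf_embed] at this
    simpa using this (by simpa using hF)

theorem sLe_of_forall_sElt_le {x y : CanExt L}
    (h : ∀ P, IsSFilter σ P → SLe σ (sElt σ P) x → SLe σ (sElt σ P) y) : SLe σ x y := by
  rw [← sLe_opp]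
  refine sLe_of_forall_le_sElt fun Q hQ hy => ?_
  rw [Sgn.opp_opp] at hQ hy ⊢
  exact sLe_opp.2 (h Q hQ (sLe_opp.1 hy))

/-- An inequality `x ≤ o` with `o` open, in terms of the closed elements below `x`. -/
theorem sLe_sElt_opp_iff (hQ : IsSFilter σ.opp Q) {x : CanExt L} :
    SLe σ x (sElt σ.opp Q) ↔
      ∀ P, IsSFilter σ P → SLe σ (sElt σ P) x → ∃ a ∈ P, a ∈ Q :=
  ⟨fun h _ hP hx => (sElt_le_sElt_opp hP hQ).1 (hx.trans h),
    fun h => sLe_of_forall_sElt_le fun P hP hx => (sElt_le_sElt_opp hP hQ).2 (h P hP hx)⟩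

theorem sElt_univ_le (σ : Sgn) (x : CanExt L) : SLe σ (sElt σ (Set.univ : Set L)) x :=
  sLe_of_forall_le_sElt fun _ hQ _ =>
    (sElt_le_sElt_opp (isSFilter_univ σ) hQ).2 ⟨_, trivial, hQ.top_mem⟩

theorem sElt_le_embed_iff (hP : IsSFilter σ P) {a : L} :
    SLe σ (sElt σ P) (embed a) ↔ a ∈ P := by
  rw [← sElt_opp_Ici σ a, sElt_le_sElt_opp hP (isSFilter_Ici _ _)]
  exact ⟨fun ⟨b, hb, hab⟩ => hP.mem_of_le (sLe_opp.1 hab) hb, fun h => ⟨a, h, .refl _ _⟩⟩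

/-- By density, this set is the intersection of the signed filters `P` with `sElt σ P` below `x`. -/
theorem isSFilter_setOf_le_embed (σ : Sgn) (x : CanExt L) :
    IsSFilter σ {a : L | SLe σ x (embed a)} := by
  have h : {a : L | SLe σ x (embed a)} =
      ⋂ P ∈ {P : Set L | IsSFilter σ P ∧ SLe σ (sElt σ P) x}, P := by
    ext a
    simp only [Set.mem_ofPred_eq, Set.mem_iInter]
    refine ⟨fun h P hP => (sElt_le_embed_iff hP.1).1 (hP.2.trans h),
      fun h => sLe_of_forall_sElt_le fun P hP hx => sElt_le_embed _ (h P ⟨hP, hx⟩)⟩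
  rw [h]
  refine ⟨?_, ?_, ?_⟩ <;> simp only [Set.mem_iInter]
  · exact fun P hP => hP.1.top_mem
  · exact fun ha hb P hP => hP.1.smeet_mem (ha P hP) (hb P hP)
  · exact fun hab ha P hP => hP.1.mem_of_le hab (ha P hP)

theorem IsClosedSgn.exists_sElt {x : CanExt L} (h : IsClosedSgn σ x) :
    ∃ P, IsSFilter σ P ∧ x = sElt σ P := by
  refine ⟨_, isSFilter_setOf_le_embed σ x, (le_sElt fun a ha => ha).antisymm (σ := σ) ?_⟩
  have : ∃ X : Set L, x = sElt σ X := by cases σ <;> exact h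
  obtain ⟨X, rfl⟩ := this
  exact le_sElt fun a ha => sElt_le_embed _ (sElt_le_embed (σ := σ) ha)

end CanExt

/-! ### Operators and their extensions -/

section Operators

variable {n : ℕ}

/-- `h` preserves binary joins in each coordinate, for the orders given by the signs `η` on the
arguments and `τ` on the values. Least elements need not be preserved, so that the notion covers the
regular connectives, and binary joins, as well as the normal connectives. -/
def IsOp {M : Type*} [Lattice M] (τ : Sgn) (η : Fin n → Sgn) (h : (Fin n → M) → M) : Prop :=
  ∀ (x : Fin n → M) (i : Fin n) (a b : M),
    h (Function.update x i (smeet (η i).opp a b)) =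
      smeet τ.opp (h (Function.update x i a)) (h (Function.update x i b))

theorem IsOp.mono_update {M : Type*} [Lattice M] {τ : Sgn} {η : Fin n → Sgn}
    {h : (Fin n → M) → M} (hh : IsOp τ η h) (x : Fin n → M) (i : Fin n) {a b : M}
    (hab : SLe (η i) a b) :
    SLe τ (h (Function.update x i a)) (h (Function.update x i b)) := by
  have : smeet (η i).opp a b = b :=
    (smeet_le_right _ _ _).antisymm (le_smeet (sLe_opp.2 hab) (.refl _ _))
  rw [← sLe_opp, ← this, hh]
  exact smeet_le_left _ _ _

theorem IsOp.mono {M : Type*} [Lattice M] {τ : Sgn} {η : Fin n → Sgn}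
    {h : (Fin n → M) → M} (hh : IsOp τ η h) {a b : Fin n → M} (hab : ∀ i, SLe (η i) (a i) (b i)) :
    SLe τ (h a) (h b) := by
  have key : ∀ s : Finset (Fin n), SLe τ (h a) (h (s.piecewise b a)) := by
    intro s
    induction s using Finset.induction_on with
    | empty => simpa using SLe.refl τ (h a)
    | insert i s hi ih =>
      refine ih.trans ?_
      have h1 : s.piecewise b a = Function.update (s.piecewise b a) i (a i) := by
        rw [eq_comm, Function.update_eq_self_iff]; simp [hi]
      rw [Finset.piecewise_insert, h1, Function.update_idem]
      exact hh.mono_update _ _ (hab i)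
  simpa using key Finset.univ

variable {L : Type w} [Lattice L] [BoundedOrder L]

/-- `H` is the extension of `h` to the canonical extension. The open elements above a value of `H`
determine that value, by density, and they are those described here. -/
def IsExt (τ : Sgn) (η : Fin n → Sgn) (h : (Fin n → L) → L)
    (H : (Fin n → CanExt L) → CanExt L) : Prop :=
  ∀ (x : Fin n → CanExt L) (Q : Set L), IsSFilter τ.opp Q →
    (SLe τ (H x) (sElt τ.opp Q) ↔
      ∀ P : Fin n → Set L, (∀ i, IsSFilter (η i) (P i)) →
        (∀ i, SLe (η i) (sElt (η i) (P i)) (x i)) → ∃ a, (∀ i, a i ∈ P i) ∧ h a ∈ Q)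

theorem isSFilter_image {τ : Sgn} {η : Fin n → Sgn} {h : (Fin n → L) → L} (hh : IsOp τ η h)
    {P : Fin n → Set L} (hP : ∀ i, IsSFilter (η i) (P i)) :
    IsSFilter τ {b | ∃ a, (∀ i, a i ∈ P i) ∧ SLe τ (h a) b} := by
  refine ⟨⟨fun i => sTop (η i), fun i => (hP i).top_mem, sLe_sTop _ _⟩, ?_, ?_⟩
  · rintro b b' ⟨a, ha, hab⟩ ⟨a', ha', hab'⟩
    exact ⟨fun i => smeet (η i) (a i) (a' i), fun i => (hP i).smeet_mem (ha i) (ha' i),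
      le_smeet ((hh.mono fun i => smeet_le_left _ _ _).trans hab)
        ((hh.mono fun i => smeet_le_right _ _ _).trans hab')⟩
  · rintro b b' hb ⟨a, ha, hab⟩
    exact ⟨a, ha, hab.trans hb⟩

theorem isExt_of_forall_sLe_iff {τ : Sgn} {η : Fin n → Sgn} {h : (Fin n → L) → L}
    {H : (Fin n → CanExt L) → CanExt L} (hh : IsOp τ η h)
    (hH : ∀ x y, SLe τ (H x) y ↔ ∀ k : Fin n → CanExt L, (∀ i, IsClosedSgn (η i) (k i)) →
      (∀ i, SLe (η i) (k i) (x i)) →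
        SLe τ (sElt τ {b | ∃ a, (∀ i, SLe (η i) (k i) (embed (a i))) ∧ b = h a}) y) :
    IsExt τ η h H := by
  intro x Q hQ
  rw [hH]
  have key : ∀ P : Fin n → Set L, (∀ i, IsSFilter (η i) (P i)) →
      (SLe τ (sElt τ {b | ∃ a, (∀ i, SLe (η i) (sElt (η i) (P i)) (embed (a i))) ∧ b = h a})
        (sElt τ.opp Q) ↔ ∃ a, (∀ i, a i ∈ P i) ∧ h a ∈ Q) := by
    intro P hP
    have h1 : sElt τ {b | ∃ a, (∀ i, SLe (η i) (sElt (η i) (P i)) (embed (a i))) ∧ b = h a} =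
        sElt τ {b | ∃ a, (∀ i, a i ∈ P i) ∧ SLe τ (h a) b} := by
      refine SLe.antisymm (σ := τ) (le_sElt ?_) (le_sElt ?_)
      · rintro b ⟨a, ha, hab⟩
        refine SLe.trans (sElt_le_embed τ ?_) (embed_mono hab)
        exact ⟨a, fun i => sElt_le_embed _ (ha i), rfl⟩
      · rintro _ ⟨a, ha, rfl⟩
        exact sElt_le_embed τ ⟨a, fun i => (sElt_le_embed_iff (hP i)).1 (ha i), .refl _ _⟩
    rw [h1, sElt_le_sElt_opp (isSFilter_image hh hP) hQ]
    constructor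
    · rintro ⟨b, ⟨a, ha, hab⟩, hb⟩
      exact ⟨a, ha, hQ.mem_of_le (sLe_opp.2 hab) hb⟩
    · rintro ⟨a, ha, hb⟩
      exact ⟨h a, ⟨a, ha, .refl _ _⟩, hb⟩
  constructor
  · intro hk P hP hPx
    exact (key P hP).1 (hk _ (fun i => isClosedSgn_sElt _ _) hPx)
  · intro hP k hk hkx
    choose P hPf hkP using fun i => (hk i).exists_sElt
    obtain rfl : k = fun i => sElt (η i) (P i) := funext hkP
    exact (key P hPf).2 (hP P hPf hkx)

theorem isExt_sigmaExt {ε : Fin n → Sgn} {h : (Fin n → L) → L} (hh : IsOp .pos ε h) :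
    IsExt .pos ε h (sigmaExt ε h) := by
  refine isExt_of_forall_sLe_iff hh fun x y => ?_
  have h1 : ∀ k : Fin n → CanExt L, sigmaClosed ε h k =
      sElt .pos {b | ∃ a, (∀ i, SLe (ε i) (k i) (embed (a i))) ∧ b = h a} := by
    intro k
    refine congrArg sInf (Set.ext fun z => ⟨?_, ?_⟩)
    · rintro ⟨a, ha, rfl⟩
      exact ⟨h a, ⟨a, fun i => leSgn_iff.1 (ha i), rfl⟩, rfl⟩
    · rintro ⟨_, ⟨a, ha, rfl⟩, rfl⟩
      exact ⟨a, fun i => leSgn_iff.2 (ha i), rfl⟩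
  refine (sSup_le_iff (α := CanExt L)).trans ⟨fun hy k hk hkx => ?_, ?_⟩
  · rw [← h1]
    exact hy _ ⟨k, hk, fun i => leSgn_iff.2 (hkx i), rfl⟩
  · rintro hy _ ⟨k, hk, hkx, rfl⟩
    rw [h1]
    exact hy k hk fun i => leSgn_iff.1 (hkx i)

theorem isExt_piExt {ε : Fin n → Sgn} {h : (Fin n → L) → L}
    (hh : IsOp .neg (fun i => (ε i).opp) h) :
    IsExt .neg (fun i => (ε i).opp) h (piExt ε h) := by
  refine isExt_of_forall_sLe_iff hh fun x y => ?_
  have h1 : ∀ k : Fin n → CanExt L, piOpen ε h k =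
      sElt .neg {b | ∃ a, (∀ i, SLe (ε i).opp (k i) (embed (a i))) ∧ b = h a} := by
    intro k
    refine congrArg sSup (Set.ext fun z => ⟨?_, ?_⟩)
    · rintro ⟨a, ha, rfl⟩
      exact ⟨h a, ⟨a, fun i => sLe_opp.2 (leSgn_iff.1 (ha i)), rfl⟩, rfl⟩
    · rintro ⟨_, ⟨a, ha, rfl⟩, rfl⟩
      exact ⟨a, fun i => leSgn_iff.2 (sLe_opp.1 (ha i)), rfl⟩
  have h2 : ∀ (σ : Sgn) (z : CanExt L), IsOpenSgn σ z ↔ IsClosedSgn σ.opp z := by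
    intro σ z; cases σ <;> rfl
  refine (le_sInf_iff (α := CanExt L)).trans ⟨fun hy k hk hkx => ?_, ?_⟩
  · rw [← h1]
    exact hy _ ⟨k, fun i => (h2 _ _).2 (hk i), fun i => leSgn_iff.2 (sLe_opp.1 (hkx i)), rfl⟩
  · rintro hy _ ⟨k, hk, hkx, rfl⟩
    rw [h1]
    exact hy k (fun i => (h2 _ _).1 (hk i)) fun i => sLe_opp.2 (leSgn_iff.1 (hkx i))

theorem isOp_smeet {M : Type*} [Lattice M] (τ : Sgn) :
    IsOp τ (fun _ => τ) (fun a : Fin 2 → M => smeet τ.opp (a 0) (a 1)) := by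
  intro x i a b
  cases τ <;> fin_cases i
  · simpa [smeet, Sgn.opp, Function.update_apply] using sup_sup_distrib_right a b (x 1)
  · simpa [smeet, Sgn.opp, Function.update_apply] using sup_sup_distrib_left (x 0) a b
  · simpa [smeet, Sgn.opp, Function.update_apply] using inf_inf_distrib_right a b (x 1)
  · simpa [smeet, Sgn.opp, Function.update_apply] using inf_inf_distrib_left (x 0) a b

/-- Binary joins extend to binary joins. -/
theorem isExt_smeet (τ : Sgn) :
    IsExt (L := L) τ (fun _ => τ) (fun a : Fin 2 → L => smeet τ.opp (a 0) (a 1))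
      (fun x => smeet τ.opp (x 0) (x 1)) := by
  intro x Q hQ
  constructor
  · intro hx P hP hPx
    have h1 : ∀ i, ∃ a ∈ P i, a ∈ Q := by
      intro i
      refine (sElt_le_sElt_opp (hP i) hQ).1 ((hPx i).trans (SLe.trans ?_ hx))
      fin_cases i
      exacts [sLe_opp.1 (smeet_le_left _ _ _), sLe_opp.1 (smeet_le_right _ _ _)]
    choose a ha haQ using h1
    exact ⟨a, ha, hQ.smeet_mem (haQ 0) (haQ 1)⟩
  · intro hP
    have h1 : ∀ i, SLe τ (x i) (sElt τ.opp Q) := by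
      intro i
      refine (sLe_sElt_opp_iff hQ).2 fun R hR hRx => ?_
      -- the other argument is bounded below by the least element
      obtain ⟨a, ha, haQ⟩ := hP (Function.update (fun _ => Set.univ) i R)
        (fun j => by
          rcases eq_or_ne j i with rfl | hj
          · simpa using hR
          · simpa [hj] using isSFilter_univ τ)
        (fun j => by
          rcases eq_or_ne j i with rfl | hj
          · simpa using hRx
          · simpa [hj] using sElt_univ_le τ (x j))
      refine ⟨a i, by simpa using ha i, hQ.mem_of_le ?_ haQ⟩
      fin_cases i
      exacts [smeet_le_left _ _ _, smeet_le_right _ _ _]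
    exact sLe_opp.1 (le_smeet (sLe_opp.2 (h1 0)) (sLe_opp.2 (h1 1)))

/-- The extension of an operator preserves nonempty joins in each coordinate: in order to bound one
of its values by an open element, the arguments can be replaced by closed elements from any
nonempty families of which they are the joins. -/
theorem IsExt.le_of_dense {τ : Sgn} {η : Fin n → Sgn} {h : (Fin n → L) → L}
    {H : (Fin n → CanExt L) → CanExt L} (hext : IsExt τ η h H) (hh : IsOp τ η h)
    {x : Fin n → CanExt L} (U : Fin n → Set (Set L))
    (hU : ∀ i, ∀ P ∈ U i, IsSFilter (η i) P) (hne : ∀ i, (U i).Nonempty)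
    (hx : ∀ i Q, IsSFilter (η i).opp Q → (∀ P ∈ U i, ∃ a ∈ P, a ∈ Q) →
      SLe (η i) (x i) (sElt (η i).opp Q))
    {Q : Set L} (hQ : IsSFilter τ.opp Q)
    (hUQ : ∀ P : Fin n → Set L, (∀ i, P i ∈ U i) → ∃ a, (∀ i, a i ∈ P i) ∧ h a ∈ Q) :
    SLe τ (H x) (sElt τ.opp Q) := by
  refine (hext x Q hQ).2 fun P₀ hP₀ hPx₀ => ?_
  -- one after the other, the members of the families are replaced by arbitrary closed elements
  have key : ∀ (s : Finset (Fin n)) (P : Fin n → Set L),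
      (∀ i ∈ s, IsSFilter (η i) (P i) ∧ SLe (η i) (sElt (η i) (P i)) (x i)) →
      (∀ i ∉ s, P i ∈ U i) → ∃ a, (∀ i, a i ∈ P i) ∧ h a ∈ Q := by
    intro s
    induction s using Finset.induction_on with
    | empty => exact fun P _ hP => hUQ P (by simpa using hP)
    | insert i s hi ih =>
      intro P hPs hPU
      have hPf : ∀ j, IsSFilter (η j) (P j) := fun j => by
        by_cases hj : j ∈ insert i s
        exacts [(hPs j hj).1, hU j _ (hPU j hj)]
      have h1 : ∀ R ∈ U i, ∃ b ∈ R, ∃ a, (∀ j, j ≠ i → a j ∈ P j) ∧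
          h (Function.update a i b) ∈ Q := by
        intro R hR
        obtain ⟨a, ha, haQ⟩ := ih (Function.update P i R)
          (fun j hj => by
            have : j ≠ i := fun h => hi (h ▸ hj)
            simpa [this] using hPs j (Finset.mem_insert_of_mem hj))
          (fun j hj => by
            rcases eq_or_ne j i with rfl | hji
            · simpa using hR
            · simpa [hji] using hPU j (by simp [hji, hj]))
        exact ⟨a i, by simpa using ha i, a, fun j hj => by simpa [hj] using ha j, by simpa using haQ⟩
      -- the residual of `h` in the coordinate `i`
      have hI : IsSFilter (η i).opp
          {b | ∃ a, (∀ j, j ≠ i → a j ∈ P j) ∧ h (Function.update a i b) ∈ Q} := by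
        have hup : ∀ {b b'}, SLe (η i).opp b b' →
            b ∈ {b | ∃ a, (∀ j, j ≠ i → a j ∈ P j) ∧ h (Function.update a i b) ∈ Q} →
            b' ∈ {b | ∃ a, (∀ j, j ≠ i → a j ∈ P j) ∧ h (Function.update a i b) ∈ Q} := by
          rintro b b' hbb ⟨a, ha, haQ⟩
          exact ⟨a, ha, hQ.mem_of_le (sLe_opp.2 (hh.mono_update _ _ (sLe_opp.1 hbb))) haQ⟩
        refine ⟨?_, ?_, hup⟩
        · obtain ⟨R, hR⟩ := hne i
          obtain ⟨b, -, hb⟩ := h1 R hR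
          exact hup (sLe_sTop _ _) hb
        · rintro b b' ⟨a, ha, haQ⟩ ⟨a', ha', haQ'⟩
          refine ⟨fun j => smeet (η j) (a j) (a' j),
            fun j hj => (hPf j).smeet_mem (ha j hj) (ha' j hj), ?_⟩
          have hle : ∀ (c : L) (d : Fin n → L),
              (∀ j, SLe (η j) (smeet (η j) (a j) (a' j)) (d j)) → ∀ j, SLe (η j)
              (Function.update (fun j => smeet (η j) (a j) (a' j)) i c j)
              (Function.update d i c j) := by
            intro c d hd j
            rcases eq_or_ne j i with rfl | hj
            · simpa using SLe.refl _ _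
            · simpa [hj] using hd j
          rw [hh]
          exact hQ.smeet_mem
            (hQ.mem_of_le (sLe_opp.2 (hh.mono (hle b a fun j => smeet_le_left _ _ _))) haQ)
            (hQ.mem_of_le (sLe_opp.2 (hh.mono (hle b' a' fun j => smeet_le_right _ _ _))) haQ')
      obtain ⟨b, hb, a, ha, haQ⟩ := (sElt_le_sElt_opp (hPf i) hI).1
        ((hPs i (Finset.mem_insert_self _ _)).2.trans (hx i _ hI h1))
      refine ⟨Function.update a i b, fun j => ?_, haQ⟩
      rcases eq_or_ne j i with rfl | hj
      · simpa using hb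
      · simpa [hj] using ha j hj
  exact key Finset.univ P₀ (fun i _ => ⟨hP₀ i, hPx₀ i⟩) (by simp)

theorem IsExt.mono {τ : Sgn} {η : Fin n → Sgn} {h : (Fin n → L) → L}
    {H : (Fin n → CanExt L) → CanExt L} (hext : IsExt τ η h H) {x y : Fin n → CanExt L}
    (hxy : ∀ i, SLe (η i) (x i) (y i)) : SLe τ (H x) (H y) :=
  sLe_of_forall_le_sElt fun Q hQ hy => (hext x Q hQ).2 fun P hP hPx =>
    (hext y Q hQ).1 hy P hP fun i => (hPx i).trans (hxy i)

end Operators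

/-! ### Terms as compositions of operators -/

section Terms

variable {S : Signature.{u, v}}

theorem Term.child_induction {motive : Term S → Prop}
    (h : ∀ t : Term S, (∀ i, motive (t.child i)) → motive t) (t : Term S) : motive t := by
  induction t with
  | var p => exact h _ fun i => i.elim0
  | bot => exact h _ fun i => i.elim0
  | top => exact h _ fun i => i.elim0
  | and s t hs ht =>
    refine h _ fun i => ?_
    change Fin 2 at i
    fin_cases i
    exacts [hs, ht]
  | or s t hs ht =>
    refine h _ fun i => ?_
    change Fin 2 at i
    fin_cases i
    exacts [hs, ht]
  | fapp f a ha => exact h _ ha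
  | gapp g a ha => exact h _ ha

/-- The sign of the order in which the root connective preserves joins. A node that is not a
variable or a constant is a Skeleton node if its sign is this one, and can only be a PIA node
otherwise. (The value at variables is irrelevant.) -/
def Term.rootSign : Term S → Sgn
  | .var _ => .pos
  | .bot => .pos
  | .top => .neg
  | .and _ _ => .neg
  | .or _ _ => .pos
  | .fapp _ _ => .pos
  | .gapp _ _ => .neg

/-- The operation that the root connective denotes. (The value at variables is irrelevant.) -/
def Ops.rootOp {M : Type*} [Lattice M] [BoundedOrder M] (A : Ops S M) :
    (t : Term S) → (Fin t.arity → M) → M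
  | .var _ => fun _ => ⊥
  | .bot => fun _ => ⊥
  | .top => fun _ => ⊤
  | .and _ _ => fun a : Fin 2 → M => a 0 ⊓ a 1
  | .or _ _ => fun a : Fin 2 → M => a 0 ⊔ a 1
  | .fapp f _ => A.opF f
  | .gapp g _ => A.opG g

theorem Ops.eval_eq_rootOp {M : Type*} [Lattice M] [BoundedOrder M] (A : Ops S M) (h : ℕ → M)
    {t : Term S} (ht : ∀ p, t ≠ .var p) :
    A.eval h t = A.rootOp t (fun i => A.eval h (t.child i)) := by
  cases t with
  | var p => exact absurd rfl (ht p)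
  | _ => rfl

theorem Sgn.pos_mul (ε : Sgn) : Sgn.pos.mul ε = ε := by cases ε <;> rfl

theorem Sgn.neg_mul (ε : Sgn) : Sgn.neg.mul ε = ε.opp := by cases ε <;> rfl

theorem childSign_opp (σ : Sgn) (t : Term S) (i : Fin t.arity) :
    childSign σ.opp t i = (childSign σ t i).opp := by
  unfold childSign
  cases σ <;> cases t.rootType i <;> rfl

theorem Term.vars_child_subset (t : Term S) (i : Fin t.arity) : (t.child i).vars ⊆ t.vars := by
  cases t with
  | var p => exact i.elim0
  | bot => exact i.elim0
  | top => exact i.elim0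
  | and s t =>
    change Fin 2 at i
    fin_cases i
    exacts [Set.subset_union_left, Set.subset_union_right]
  | or s t =>
    change Fin 2 at i
    fin_cases i
    exacts [Set.subset_union_left, Set.subset_union_right]
  | fapp f a => exact Set.subset_iUnion (fun i => (a i).vars) i
  | gapp g a => exact Set.subset_iUnion (fun i => (a i).vars) i

theorem Ops.dependsOn_eval {M : Type*} [Lattice M] [BoundedOrder M] (A : Ops S M) (t : Term S) :
    DependsOn (fun h => A.eval h t) t.vars := by
  induction t using Term.child_induction with
  | h t ih =>
    intro h h' hh
    by_cases ht : ∀ p, t ≠ .var p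
    · simp only [A.eval_eq_rootOp _ ht]
      exact congrArg _ (funext fun i => ih i fun k hk => hh k (t.vars_child_subset i hk))
    · push Not at ht
      obtain ⟨p, rfl⟩ := ht
      exact hh p rfl

theorem Agrees.child {ε : ℕ → Sgn} {σ : Sgn} {t : Term S} (h : Agrees ε σ t) (i : Fin t.arity) :
    Agrees ε (childSign σ t i) (t.child i) :=
  fun b => h (.step σ t i b)

theorem Branch.exists_opp {σ : Sgn} {t : Term S} (b : Branch σ t) :
    ∀ σ', σ = Sgn.opp σ' → ∃ b' : Branch σ' t, b'.leafVar = b.leafVar ∧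
      b.leafSign = b'.leafSign.opp := by
  induction b with
  | leaf σ p => rintro σ' rfl; exact ⟨.leaf σ' p, rfl, rfl⟩
  | step σ t i b ih =>
    rintro σ' rfl
    obtain ⟨b', h1, h2⟩ := ih _ (childSign_opp σ' t i)
    exact ⟨.step σ' t i b', h1, h2⟩

theorem Agrees.opp {ε : ℕ → Sgn} {σ : Sgn} {t : Term S} (h : Agrees (fun p => (ε p).opp) σ t) :
    Agrees ε σ.opp t := by
  intro b
  obtain ⟨b', h1, h2⟩ := b.exists_opp σ rfl
  have : b'.leafSign = (ε b'.leafVar).opp := h b'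
  rw [Branch.Critical, h2, this, h1, Sgn.opp_opp]

theorem agrees_opp_iff {ε : ℕ → Sgn} {σ : Sgn} {t : Term S} :
    Agrees (fun p => (ε p).opp) σ t ↔ ∀ b : Branch σ t, ¬ b.Critical ε :=
  forall_congr' fun _ => Sgn.eq_opp_iff

theorem childSign_fapp (f : S.F) (a : Fin (S.arF f) → Term S) :
    childSign (Term.fapp f a).rootSign (Term.fapp f a) = S.epsF f :=
  funext fun _ => Sgn.pos_mul _

theorem childSign_gapp (g : S.G) (a : Fin (S.arG g) → Term S) :
    childSign (Term.gapp g a).rootSign (Term.gapp g a) = fun i => (S.epsG g i).opp :=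
  funext fun _ => Sgn.neg_mul _

/-- Monotonicity of signed terms, in any algebra whose operations are monotone. -/
theorem Ops.eval_mono {M : Type*} [Lattice M] [BoundedOrder M] {A : Ops S M}
    (hA : ∀ (t : Term S) (a b : Fin t.arity → M),
      (∀ i, SLe (childSign t.rootSign t i) (a i) (b i)) →
        SLe t.rootSign (A.rootOp t a) (A.rootOp t b))
    {ε : ℕ → Sgn} {h h' : ℕ → M} (hh : ∀ p, SLe (ε p) (h p) (h' p)) (t : Term S) :
    ∀ σ, Agrees ε σ t → SLe σ (A.eval h t) (A.eval h' t) := by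
  induction t using Term.child_induction with
  | h t ih =>
    intro σ hσ
    by_cases ht : ∀ p, t ≠ .var p
    · simp only [A.eval_eq_rootOp _ ht]
      rcases σ.eq_or_eq_opp t.rootSign with rfl | rfl
      · exact hA t _ _ fun i => ih i _ (hσ.child i)
      · refine sLe_opp.2 (hA t _ _ fun i => sLe_opp.1 ?_)
        rw [← childSign_opp]
        exact ih i _ (hσ.child i)
    · push Not at ht
      obtain ⟨p, rfl⟩ := ht
      obtain rfl : σ = ε p := hσ (.leaf σ p)
      exact hh p

variable {L : Type w} [Lattice L] [BoundedOrder L] {A : Ops S L}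

theorem Ops.IsLatticeExpansion.isOp_opF (hA : A.IsLatticeExpansion) (f : S.F) :
    IsOp .pos (S.epsF f) (A.opF f) := by
  intro x i a b
  cases h : S.epsF f i
  exacts [hA.f_pos f x i a b h, hA.f_neg f x i a b h]

theorem Ops.IsLatticeExpansion.isOp_opG (hA : A.IsLatticeExpansion) (g : S.G) :
    IsOp .neg (fun i => (S.epsG g i).opp) (A.opG g) := by
  intro x i a b
  simp only [Sgn.opp_opp]
  cases h : S.epsG g i
  exacts [hA.g_pos g x i a b h, hA.g_neg g x i a b h]

theorem Ops.IsLatticeExpansion.isOp_rootOp (hA : A.IsLatticeExpansion) (t : Term S) :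
    IsOp t.rootSign (childSign t.rootSign t) (A.rootOp t) := by
  cases t with
  | var p => exact fun _ i => i.elim0
  | bot => exact fun _ i => i.elim0
  | top => exact fun _ i => i.elim0
  | and s t => exact isOp_smeet .neg
  | or s t => exact isOp_smeet .pos
  | fapp f a =>
    rw [childSign_fapp]
    exact hA.isOp_opF f
  | gapp g a =>
    rw [childSign_gapp]
    exact hA.isOp_opG g

theorem Ops.IsLatticeExpansion.isExt_rootOp (hA : A.IsLatticeExpansion) (t : Term S) :
    IsExt t.rootSign (childSign t.rootSign t) (A.rootOp t) (A.canExt.rootOp t) := by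
  have hbot : ∀ (τ : Sgn) (η : Fin 0 → Sgn),
      IsExt (L := L) τ η (fun _ => sTop τ.opp) (fun _ => sTop τ.opp) := fun τ η x Q hQ =>
    ⟨fun _ P _ _ => ⟨fun i => i.elim0, fun i => i.elim0, hQ.top_mem⟩,
      fun _ => sLe_opp.1 (sLe_sTop _ _)⟩
  cases t with
  | var p => exact hbot .pos _
  | bot => exact hbot .pos _
  | top => exact hbot .neg _
  | and s t => exact isExt_smeet .neg
  | or s t => exact isExt_smeet .pos
  | fapp f a =>
    rw [childSign_fapp]
    exact isExt_sigmaExt (hA.isOp_opF f)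
  | gapp g a =>
    rw [childSign_gapp]
    exact isExt_piExt (hA.isOp_opG g)

theorem Ops.IsLatticeExpansion.eval_mono (hA : A.IsLatticeExpansion) {ε : ℕ → Sgn}
    {h h' : ℕ → L} (hh : ∀ p, SLe (ε p) (h p) (h' p)) {t : Term S} {σ : Sgn}
    (ht : Agrees ε σ t) : SLe σ (A.eval h t) (A.eval h' t) :=
  Ops.eval_mono (fun t _ _ => (hA.isOp_rootOp t).mono) hh t σ ht

theorem Ops.IsLatticeExpansion.eval_canExt_mono (hA : A.IsLatticeExpansion) {ε : ℕ → Sgn}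
    {h h' : ℕ → CanExt L} (hh : ∀ p, SLe (ε p) (h p) (h' p)) {t : Term S} {σ : Sgn}
    (ht : Agrees ε σ t) : SLe σ (A.canExt.eval h t) (A.canExt.eval h' t) :=
  Ops.eval_mono (fun t _ _ => (hA.isExt_rootOp t).mono) hh t σ ht

end Terms

/-! ### Minimal valuations -/

section Valuations

variable {L : Type w} [Lattice L] [BoundedOrder L] {ε : ℕ → Sgn}

/-- The product order on valuations that is given by the signs `ε`. -/
def VLe (ε : ℕ → Sgn) (h h' : ℕ → L) : Prop := ∀ p, SLe (ε p) (h p) (h' p)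

/-- A family of signed filters that approximates the valuation `x` in the canonical extension from
below: its members stand for the values of an `ε`-closed valuation under `x`, and the valuations in
`L` above that one are those with `h p ∈ V p` for all `p`. -/
structure IsClosedBelow (ε : ℕ → Sgn) (x : ℕ → CanExt L) (V : ℕ → Set L) : Prop where
  isSFilter : ∀ p, IsSFilter (ε p) (V p)
  sElt_le : ∀ p, SLe (ε p) (sElt (ε p) (V p)) (x p)

/-- A signed filter that depends on a valuation, and grows as the valuation gets smaller. -/
structure IsParamFilter (ε : ℕ → Sgn) (σ : Sgn) (R : (ℕ → L) → Set L) : Prop where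
  isSFilter : ∀ h, IsSFilter σ (R h)
  anti : ∀ {h h'}, VLe ε h h' → R h' ⊆ R h

/-- The value of a parametrised filter at the closed valuation given by `V`. -/
def limFilter (R : (ℕ → L) → Set L) (V : ℕ → Set L) : Set L :=
  {a | ∃ h, (∀ p, h p ∈ V p) ∧ a ∈ R h}

theorem exists_vLe_of_finite {V : ℕ → Set L} (hV : ∀ p, IsSFilter (ε p) (V p)) {ι : Type*}
    [Finite ι] (h : ι → ℕ → L) (hh : ∀ i p, h i p ∈ V p) :
    ∃ h', (∀ p, h' p ∈ V p) ∧ ∀ i, VLe ε h' (h i) := by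
  have : ∀ p, ∃ a ∈ V p, ∀ i, SLe (ε p) a (h i p) := fun p =>
    (hV p).exists_forall_mem (fun i a => SLe (ε p) a (h i p)) (fun _ _ _ => SLe.trans)
      fun i => ⟨_, hh i p, .refl _ _⟩
  choose h' h1 h2 using this
  exact ⟨h', h1, fun i p => h2 p i⟩

theorem exists_vLe_vLe {V : ℕ → Set L} (hV : ∀ p, IsSFilter (ε p) (V p)) {h h' : ℕ → L}
    (hh : ∀ p, h p ∈ V p) (hh' : ∀ p, h' p ∈ V p) :
    ∃ k, (∀ p, k p ∈ V p) ∧ VLe ε k h ∧ VLe ε k h' :=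
  ⟨fun p => smeet (ε p) (h p) (h' p), fun p => (hV p).smeet_mem (hh p) (hh' p),
    fun _ => smeet_le_left _ _ _, fun _ => smeet_le_right _ _ _⟩

theorem IsParamFilter.limFilter {σ : Sgn} {R : (ℕ → L) → Set L} (hR : IsParamFilter ε σ R)
    {V : ℕ → Set L} (hV : ∀ p, IsSFilter (ε p) (V p)) : IsSFilter σ (limFilter R V) := by
  refine ⟨⟨fun p => sTop (ε p), fun p => (hV p).top_mem, (hR.isSFilter _).top_mem⟩, ?_, ?_⟩
  · rintro a a' ⟨h, hh, ha⟩ ⟨h', hh', ha'⟩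
    obtain ⟨k, hk, h1, h2⟩ := exists_vLe_vLe hV hh hh'
    exact ⟨k, hk, (hR.isSFilter _).smeet_mem (hR.anti h1 ha) (hR.anti h2 ha')⟩
  · rintro a a' haa ⟨h, hh, ha⟩
    exact ⟨h, hh, (hR.isSFilter _).mem_of_le haa ha⟩

section MinimalValuation

variable {ι : Type*} (Ω : ℕ → ℕ → Prop) (p : ι → ℕ) (R : ι → (ℕ → L) → Set L)

/-- The minimal solution of the demands `sElt (limFilter (R i) V) ≤ V (p i)`: the signed filter
`MinVal Ω p R q` is the intersection of the filters `limFilter (R i) (MinVal Ω p R)` over the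
demands `i` on the variable `q`, where only variables `r` with `Ω r q` are constrained. -/
inductive MinVal : ℕ → L → Prop
  | intro (q : ℕ) (a : L) (h : ι → ℕ → L)
      (h₁ : ∀ i, p i = q → ∀ r, Ω r q → MinVal r (h i r))
      (h₂ : ∀ i, p i = q → a ∈ R i (h i)) : MinVal q a

variable {Ω p R}

/-- On the finitely many variables with demands the relation `Ω` is well-founded, and has a rank
function. -/
theorem exists_rank [Finite ι] (hirr : ∀ q, ¬ Ω q q) (htr : ∀ q r s, Ω q r → Ω r s → Ω q s)
    (p : ι → ℕ) :
    ∃ rank : ℕ → ℕ, ∀ i r, Ω r (p i) → rank r < rank (p i) := by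
  classical
  refine ⟨fun q => if q ∈ Set.range p then {r ∈ Set.range p | Ω r q}.ncard + 1 else 0, ?_⟩
  intro i r hr
  have hfin : {s ∈ Set.range p | Ω s (p i)}.Finite := (Set.finite_range p).subset fun _ h => h.1
  by_cases hrp : r ∈ Set.range p
  · simp only [hrp, Set.mem_range_self, if_true]
    refine Nat.succ_lt_succ (Set.ncard_lt_ncard ?_ hfin)
    have hsub : {s ∈ Set.range p | Ω s r} ⊆ {s ∈ Set.range p | Ω s (p i)} :=
      fun s hs => ⟨hs.1, htr _ _ _ hs.2 hr⟩
    exact (Set.ssubset_iff_of_subset hsub).2 ⟨r, ⟨hrp, hr⟩, fun h => hirr r h.2⟩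
  · simp [hrp]

theorem isSFilter_minVal [Finite ι] (hirr : ∀ q, ¬ Ω q q)
    (htr : ∀ q r s, Ω q r → Ω r s → Ω q s) (hR : ∀ i, IsParamFilter ε (ε (p i)) (R i))
    (q : ℕ) : IsSFilter (ε q) {a | MinVal Ω p R q a} := by
  obtain ⟨rank, hrank⟩ := exists_rank hirr htr p
  refine ⟨?_, ?_, ?_⟩
  · change MinVal Ω p R q (sTop (ε q))
    induction hn : rank q using Nat.strong_induction_on generalizing q with
    | _ n ih =>
      refine .intro q _ (fun _ r => sTop (ε r)) ?_ ?_
      · rintro i rfl r hr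
        exact ih _ (hn ▸ hrank i r hr) r rfl
      · rintro i rfl
        exact ((hR i).isSFilter _).top_mem
  · intro a b ha hb
    change MinVal Ω p R q a at ha
    change MinVal Ω p R q b at hb
    change MinVal Ω p R q (smeet (ε q) a b)
    induction ha generalizing b with
    | intro q a h h₁ h₂ ih =>
      obtain ⟨_, _, h', h₁', h₂'⟩ := hb
      refine .intro q _ (fun i r => smeet (ε r) (h i r) (h' i r)) ?_ ?_
      · exact fun i hi r hr => ih i hi r hr (h₁' i hi r hr)
      · rintro i rfl
        exact ((hR i).isSFilter _).smeet_mem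
          ((hR i).anti (fun _ => smeet_le_left _ _ _) (h₂ i rfl))
          ((hR i).anti (fun _ => smeet_le_right _ _ _) (h₂' i rfl))
  · rintro a b hab ⟨_, _, h, h₁, h₂⟩
    refine .intro q b h h₁ ?_
    rintro i rfl
    exact ((hR i).isSFilter _).mem_of_le hab (h₂ i rfl)

theorem isClosedBelow_minVal [Finite ι] (hirr : ∀ q, ¬ Ω q q)
    (htr : ∀ q r s, Ω q r → Ω r s → Ω q s) (hR : ∀ i, IsParamFilter ε (ε (p i)) (R i))
    {x : ℕ → CanExt L}
    (hx : ∀ i V, IsClosedBelow ε x V →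
      SLe (ε (p i)) (sElt (ε (p i)) (limFilter (R i) V)) (x (p i))) :
    IsClosedBelow ε x (fun q => {a | MinVal Ω p R q a}) := by
  classical
  obtain ⟨rank, hrank⟩ := exists_rank hirr htr p
  have hfil := isSFilter_minVal (ε := ε) hirr htr hR
  refine ⟨hfil, fun q => ?_⟩
  induction hn : rank q using Nat.strong_induction_on generalizing q with
  | _ n ih =>
    refine sLe_of_forall_le_sElt fun Q hQ hxQ => (sElt_le_sElt_opp (hfil q) hQ).2 ?_
    -- the minimal valuation, with all variables made trivial that are not below `q`
    have hV : ∀ i, p i = q → IsClosedBelow ε x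
        (fun r => if Ω r q then {a | MinVal Ω p R r a} else Set.univ) := by
      rintro i rfl
      refine ⟨fun r => ?_, fun r => ?_⟩ <;> by_cases hr : Ω r (p i)
      · simpa [hr] using hfil r
      · simpa [hr] using isSFilter_univ (ε r)
      · simpa [hr] using ih _ (hn ▸ hrank i r hr) r rfl
      · simpa [hr] using sElt_univ_le (ε r) (x r)
    obtain ⟨a, haQ, ha⟩ := hQ.exists_forall_mem (ι := {i // p i = q})
      (fun i a => a ∈ limFilter (R i) fun r => if Ω r q then {a | MinVal Ω p R r a} else Set.univ)
      (by
        rintro ⟨i, rfl⟩ a b hab hb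
        exact ((hR i).limFilter (hV i rfl).isSFilter).mem_of_le (sLe_opp.1 hab) hb)
      (by
        rintro ⟨i, rfl⟩
        obtain ⟨a, ha, haQ⟩ := (sElt_le_sElt_opp ((hR i).limFilter (hV i rfl).isSFilter) hQ).1
          ((hx i _ (hV i rfl)).trans hxQ)
        exact ⟨a, haQ, ha⟩)
    choose h h₁ h₂ using ha
    refine ⟨a, .intro q a (fun i => if hi : p i = q then h ⟨i, hi⟩ else fun _ => a) ?_ ?_, haQ⟩
    · intro i hi r hr
      simpa [hi, hr] using h₁ ⟨i, hi⟩ r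
    · intro i hi
      simpa [hi] using h₂ ⟨i, hi⟩

/-- Finitely many demands that hold for a valuation in the canonical extension are met by a
valuation in `L`. This valuation is chosen above the minimal one, and its values are fixed from the
`Ω`-large variables downwards: once the value of `q` is fixed, the demands on `q` hold as soon as the
values of the smaller variables are close enough to the minimal ones. -/
theorem exists_valuation [Finite ι] (hirr : ∀ q, ¬ Ω q q)
    (htr : ∀ q r s, Ω q r → Ω r s → Ω q s) (hR : ∀ i, IsParamFilter ε (ε (p i)) (R i))
    (hdep : ∀ i, DependsOn (R i) {q | Ω q (p i)}) {x : ℕ → CanExt L}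
    (hx : ∀ i V, IsClosedBelow ε x V →
      SLe (ε (p i)) (sElt (ε (p i)) (limFilter (R i) V)) (x (p i)))
    {Φ : Set (ℕ → L)} (hΦ : ∀ {h h'}, VLe ε h h' → h' ∈ Φ → h ∈ Φ)
    (hΦx : ∀ V, IsClosedBelow ε x V → ∃ h, (∀ q, h q ∈ V q) ∧ h ∈ Φ) :
    ∃ h ∈ Φ, ∀ i, h (p i) ∈ R i h := by
  classical
  obtain ⟨rank, hrank⟩ := exists_rank hirr htr p
  have hV := isClosedBelow_minVal (ε := ε) hirr htr hR hx
  set V : ℕ → Set L := fun q => {a | MinVal Ω p R q a}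
  obtain ⟨B, hB⟩ : ∃ B, ∀ i, rank (p i) < B := by
    obtain ⟨B, hB⟩ := (Set.finite_range fun i => rank (p i)).bddAbove
    exact ⟨B + 1, fun i => Nat.lt_succ_of_le (hB ⟨i, rfl⟩)⟩
  have key : ∀ n m, m + n = B → ∃ N, (∀ q, N q ∈ V q) ∧
      ∀ h, (∀ q, h q ∈ V q) → VLe ε h N → (∀ q, m ≤ rank q → h q = N q) →
        h ∈ Φ ∧ ∀ i, m ≤ rank (p i) → h (p i) ∈ R i h := by
    intro n
    induction n with
    | zero =>
      rintro m rfl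
      obtain ⟨N, hN, hNΦ⟩ := hΦx V hV
      exact ⟨N, hN, fun h _ hle _ => ⟨hΦ hle hNΦ, fun i hi => absurd hi (hB i).not_ge⟩⟩
    | succ n ih =>
      intro m hm
      obtain ⟨N, hN, hNh⟩ := ih (m + 1) (by omega)
      have hw : ∀ i, ∃ k : ℕ → L, (∀ r, Ω r (p i) → k r ∈ V r) ∧ N (p i) ∈ R i k := by
        intro i
        obtain ⟨_, _, h, h₁, h₂⟩ : MinVal Ω p R (p i) (N (p i)) := hN (p i)
        exact ⟨h i, h₁ i rfl, h₂ i rfl⟩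
      choose k hkV hkN using hw
      have hN' : ∀ q, ∃ a ∈ V q, SLe (ε q) a (N q) ∧ (m ≤ rank q → a = N q) ∧
          ∀ i, rank (p i) = m → Ω q (p i) → SLe (ε q) a (k i q) := by
        intro q
        by_cases hq : m ≤ rank q
        · refine ⟨N q, hN q, .refl _ _, fun _ => rfl, fun i hi hqi => ?_⟩
          have := hrank i q hqi
          omega
        · obtain ⟨a, ha, ha'⟩ := (hV.isSFilter q).exists_forall_mem
            (fun i b => Ω q (p i) → SLe (ε q) b (k i q))
            (fun i b c hbc hc hq => hbc.trans (hc hq))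
            (fun i => by
              by_cases hqi : Ω q (p i)
              · exact ⟨_, hkV i q hqi, fun _ => .refl _ _⟩
              · exact ⟨_, (hV.isSFilter q).top_mem, fun h => absurd h hqi⟩)
          exact ⟨smeet (ε q) (N q) a, (hV.isSFilter q).smeet_mem (hN q) ha,
            smeet_le_left _ _ _, fun h => absurd h hq,
            fun i _ hqi => (smeet_le_right _ _ _).trans (ha' i hqi)⟩
      choose N' hN'V hN'N hN'eq hN'k using hN'
      refine ⟨N', hN'V, fun h hhV hhN' hheq => ?_⟩
      have hhN : ∀ q, m ≤ rank q → h q = N q := fun q hq => (hheq q hq).trans (hN'eq q hq)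
      obtain ⟨h1, h2⟩ := hNh h hhV (fun q => (hhN' q).trans (hN'N q))
        (fun q hq => hhN q (by omega))
      refine ⟨h1, fun i hi => ?_⟩
      rcases Nat.lt_or_eq_of_le hi with hi | hi
      · exact h2 i hi
      · -- `R i` depends only on variables where `h` is below `k i`
        have h3 : R i (k i) = R i (fun q => if Ω q (p i) then k i q else h q) :=
          hdep i fun q hq => (if_pos hq).symm
        have h4 := hkN i
        rw [h3, ← hhN _ hi.le] at h4
        refine (hR i).anti (fun q => ?_) h4
        by_cases hq : Ω q (p i)
        · simpa [hq] using (hhN' q).trans (hN'k q i hi.symm hq)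
        · simpa [hq] using SLe.refl _ _
  obtain ⟨N, hN, hNh⟩ := key B 0 (by simp)
  obtain ⟨h1, h2⟩ := hNh N hN (fun _ => .refl _ _) (fun _ _ => rfl)
  exact ⟨N, h1, fun i => h2 i (Nat.zero_le _)⟩

end MinimalValuation

/-- The demands on valuations `h` in `L` that a valuation `x` in the canonical extension gives rise
to: demands that hold near every closed valuation below `x`, and lower bounds for the value of a
variable in terms of the values of `Ω`-smaller variables. -/
inductive Demand (Ω : ℕ → ℕ → Prop) (ε : ℕ → Sgn) (x : ℕ → CanExt L) : Set (ℕ → L) → Prop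
  | near (Φ : Set (ℕ → L)) (hΦ : ∀ h h', VLe ε h h' → h' ∈ Φ → h ∈ Φ)
      (hx : ∀ V, IsClosedBelow ε x V → ∃ h, (∀ q, h q ∈ V q) ∧ h ∈ Φ) : Demand Ω ε x Φ
  | atVar (p : ℕ) (R : (ℕ → L) → Set L) (hR : IsParamFilter ε (ε p) R)
      (hdep : DependsOn R {q | Ω q p})
      (hx : ∀ V, IsClosedBelow ε x V → SLe (ε p) (sElt (ε p) (limFilter R V)) (x p)) :
      Demand Ω ε x {h | h p ∈ R h}

/-- The filter of sets of valuations in `L` that is generated by the demands of `x`. -/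
def demandFilter (Ω : ℕ → ℕ → Prop) (ε : ℕ → Sgn) (x : ℕ → CanExt L) : Filter (ℕ → L) :=
  Filter.generate {Φ | Demand Ω ε x Φ}

theorem Demand.eventually {Ω : ℕ → ℕ → Prop} {x : ℕ → CanExt L} {Φ : Set (ℕ → L)}
    (hΦ : Demand Ω ε x Φ) : ∀ᶠ h in demandFilter Ω ε x, h ∈ Φ :=
  Filter.mem_generate_of_mem hΦ

theorem demandFilter_neBot {Ω : ℕ → ℕ → Prop} (hirr : ∀ q, ¬ Ω q q)
    (htr : ∀ q r s, Ω q r → Ω r s → Ω q s) (x : ℕ → CanExt L) :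
    (demandFilter Ω ε x).NeBot := by
  refine Filter.generate_neBot_iff.2 fun t ht hfin => ?_
  have : Finite t := hfin
  let IsNear : Set (ℕ → L) → Prop := fun Φ => (∀ h h', VLe ε h h' → h' ∈ Φ → h ∈ Φ) ∧
    ∀ V, IsClosedBelow ε x V → ∃ h, (∀ q, h q ∈ V q) ∧ h ∈ Φ
  have hvar : ∀ Φ : {Φ : t // ¬ IsNear Φ}, ∃ (p : ℕ) (R : (ℕ → L) → Set L),
      IsParamFilter ε (ε p) R ∧ DependsOn R {q | Ω q p} ∧
      (∀ V, IsClosedBelow ε x V → SLe (ε p) (sElt (ε p) (limFilter R V)) (x p)) ∧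
      (Φ : Set (ℕ → L)) = {h | h p ∈ R h} := by
    rintro ⟨⟨Φ, hΦ⟩, hn⟩
    cases ht hΦ with
    | near _ h1 h2 => exact absurd ⟨h1, h2⟩ hn
    | atVar p R h1 h2 h3 => exact ⟨p, R, h1, h2, h3, rfl⟩
  choose p R hR hdep hx heq using hvar
  obtain ⟨h, hh, hh'⟩ := exists_valuation (ε := ε) hirr htr hR hdep hx
    (Φ := {h | ∀ Φ : {Φ : t // IsNear Φ}, h ∈ (Φ : Set (ℕ → L))})
    (fun hle hmem Φ => Φ.2.1 _ _ hle (hmem Φ))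
    (fun V hV => by
      choose k hk hk' using fun Φ : {Φ : t // IsNear Φ} => Φ.2.2 V hV
      obtain ⟨h, hh, hle⟩ := exists_vLe_of_finite hV.isSFilter k hk
      exact ⟨h, hh, fun Φ => Φ.2.1 _ _ (hle Φ) (hk' Φ)⟩)
  refine ⟨h, fun Φ hΦ => ?_⟩
  by_cases hn : IsNear Φ
  · exact hh ⟨⟨Φ, hΦ⟩, hn⟩
  · have := hh' ⟨⟨Φ, hΦ⟩, hn⟩
    have h2 := heq ⟨⟨Φ, hΦ⟩, hn⟩
    change Φ = _ at h2
    rw [h2]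
    exact this

end Valuations

/-! ### Uncritical terms near a closed valuation -/

section Uncritical

variable {S : Signature.{u, v}} {L : Type w} [Lattice L] [BoundedOrder L] {A : Ops S L}
  {ε : ℕ → Sgn}

/-- The `σ`-upper bounds of the values of `t` at the valuations in `L` that approximate the closed
valuation given by `V`. -/
def limEval (A : Ops S L) (σ : Sgn) (t : Term S) (V : ℕ → Set L) : Set L :=
  {b | ∃ h, (∀ p, h p ∈ V p) ∧ SLe σ (A.eval h t) b}

theorem isSFilter_limEval (hA : A.IsLatticeExpansion) {σ : Sgn} {t : Term S} (ht : Agrees ε σ t)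
    {V : ℕ → Set L} (hV : ∀ p, IsSFilter (ε p) (V p)) : IsSFilter σ (limEval A σ t V) := by
  refine ⟨⟨fun p => sTop (ε p), fun p => (hV p).top_mem, sLe_sTop _ _⟩, ?_, ?_⟩
  · rintro b b' ⟨h, hh, hb⟩ ⟨h', hh', hb'⟩
    obtain ⟨k, hk, h1, h2⟩ := exists_vLe_vLe hV hh hh'
    exact ⟨k, hk, le_smeet ((hA.eval_mono h1 ht).trans hb) ((hA.eval_mono h2 ht).trans hb')⟩
  · rintro b b' hbb ⟨h, hh, hb⟩
    exact ⟨h, hh, hb.trans hbb⟩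

/-- Intersection lemma: if all variable leaves of the signed term `t` agree with `ε`, then the value
of `t` at an `ε`-closed valuation is the `σ`-meet of its values at the valuations in `L` above it.
(The inequality that is not a matter of monotonicity is stated.) -/
theorem sElt_limEval_le (hA : A.IsLatticeExpansion) {V : ℕ → Set L}
    (hV : ∀ p, IsSFilter (ε p) (V p)) (t : Term S) :
    ∀ σ, Agrees ε σ t → SLe σ (sElt σ (limEval A σ t V))
      (A.canExt.eval (fun p => sElt (ε p) (V p)) t) := by
  induction t using Term.child_induction with
  | h t ih =>
    intro σ hσ
    by_cases ht : ∀ p, t ≠ .var p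
    · rw [A.canExt.eval_eq_rootOp _ ht]
      rcases σ.eq_or_eq_opp t.rootSign with rfl | rfl
      · refine sLe_of_forall_le_sElt fun Q hQ hxQ => ?_
        obtain ⟨a, ha, haQ⟩ := (hA.isExt_rootOp t _ Q hQ).1 hxQ _
          (fun i => isSFilter_limEval hA (hσ.child i) hV) (fun i => ih i _ (hσ.child i))
        choose h hh hha using ha
        obtain ⟨k, hk, hle⟩ := exists_vLe_of_finite hV h hh
        refine (sElt_le_sElt_opp (isSFilter_limEval hA hσ hV) hQ).2 ⟨_, ⟨k, hk, ?_⟩, haQ⟩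
        rw [A.eval_eq_rootOp _ ht]
        exact (hA.isOp_rootOp t).mono fun i =>
          (hA.eval_mono (hle i) (hσ.child i)).trans (hha i)
      · refine sLe_opp.2 ((hA.isExt_rootOp t _ _ (isSFilter_limEval hA hσ hV)).2 ?_)
        intro P hP hPx
        have hc : ∀ i, Agrees ε (childSign t.rootSign t i).opp (t.child i) := fun i =>
          childSign_opp t.rootSign t i ▸ hσ.child i
        have : ∀ i, ∃ a ∈ P i, a ∈ limEval A (childSign t.rootSign t i).opp (t.child i) V :=
          fun i => (sElt_le_sElt_opp (hP i) (isSFilter_limEval hA (hc i) hV)).1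
            ((hPx i).trans (sLe_opp.1 (ih i _ (hc i))))
        choose a ha h hh hha using this
        obtain ⟨k, hk, hle⟩ := exists_vLe_of_finite hV h hh
        refine ⟨a, ha, k, hk, ?_⟩
        rw [A.eval_eq_rootOp _ ht]
        exact sLe_opp.2 ((hA.isOp_rootOp t).mono fun i =>
          (sLe_opp.1 (hha i)).trans (sLe_opp.1 (hA.eval_mono (hle i) (hc i))))
    · push Not at ht
      obtain ⟨p, rfl⟩ := ht
      obtain rfl : σ = ε p := hσ (.leaf σ p)
      refine le_sElt fun b hb => sElt_le_embed _ ?_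
      exact ⟨fun q => if q = p then b else sTop (ε q), fun q => by
        by_cases hq : q = p
        · subst hq; simpa using hb
        · simpa [hq] using (hV q).top_mem, by simpa [Ops.eval] using SLe.refl _ _⟩

theorem sElt_limEval_le_of_isClosedBelow (hA : A.IsLatticeExpansion) {x : ℕ → CanExt L}
    {V : ℕ → Set L} (hV : IsClosedBelow ε x V) {t : Term S} {σ : Sgn} (ht : Agrees ε σ t) :
    SLe σ (sElt σ (limEval A σ t V)) (A.canExt.eval x t) :=
  (sElt_limEval_le hA hV.isSFilter t σ ht).trans (hA.eval_canExt_mono hV.sElt_le ht)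

end Uncritical

/-! ### PIA terms -/

section PIA

variable {S : Signature.{u, v}} {L : Type w} [Lattice L] [BoundedOrder L] {A : Ops S L}
  {Ω : ℕ → ℕ → Prop} {ε : ℕ → Sgn}

/-- An inequality `R ≤ t` with an uncritical term `t` is a demand. -/
theorem Demand.of_uncritical (hA : A.IsLatticeExpansion) {x : ℕ → CanExt L} {σ : Sgn} {t : Term S}
    (ht : Agrees (fun p => (ε p).opp) σ t) {R : (ℕ → L) → Set L} (hR : IsParamFilter ε σ R)
    (hx : ∀ V, IsClosedBelow ε x V → SLe σ (sElt σ (limFilter R V)) (A.canExt.eval x t)) :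
    Demand Ω ε x {h | A.eval h t ∈ R h} := by
  have ht' := ht.opp
  refine .near _ (fun h h' hle hh' => ?_) fun V hV => ?_
  · exact (hR.isSFilter h).mem_of_le (sLe_opp.1 (hA.eval_mono hle ht')) (hR.anti hle hh')
  · obtain ⟨a, ⟨h, hh, haR⟩, h', hh', ha⟩ :=
      (sElt_le_sElt_opp (hR.limFilter hV.isSFilter)
        (isSFilter_limEval hA ht' hV.isSFilter)).1
        ((hx V hV).trans (sLe_opp.1 (sElt_limEval_le_of_isClosedBelow hA hV ht')))
    obtain ⟨k, hk, h1, h2⟩ := exists_vLe_vLe hV.isSFilter hh hh'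
    exact ⟨k, hk, (hR.isSFilter k).mem_of_le (sLe_opp.1 ((hA.eval_mono h2 ht').trans ha))
      (hR.anti h1 haR)⟩

variable {t : Term S} {i : Fin t.arity} {R : (ℕ → L) → Set L}

/-- The value of the root connective of `t` when the argument `i` is `b` and the other arguments are
evaluated. -/
def Ops.evalUpdate (A : Ops S L) (h : ℕ → L) (t : Term S) (i : Fin t.arity) (b : L) : L :=
  A.rootOp t (Function.update (fun j => A.eval h (t.child j)) i b)

/-- The residual, in the argument `i`, of a lower bound `R` for the term `t`: the values of that
argument for which the bound is met. The least element is added, since a connective need not be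
normal. -/
def residual (A : Ops S L) (t : Term S) (i : Fin t.arity) (R : (ℕ → L) → Set L) (h : ℕ → L) :
    Set L :=
  {b | b = sTop (childSign t.rootSign.opp t i) ∨ A.evalUpdate h t i b ∈ R h}

theorem Ops.IsLatticeExpansion.evalUpdate_mono (hA : A.IsLatticeExpansion)
    (hside : ∀ j ≠ i, Agrees (fun p => (ε p).opp) (childSign t.rootSign.opp t j) (t.child j))
    {h h' : ℕ → L} (hle : VLe ε h h') (b : L) :
    SLe t.rootSign (A.evalUpdate h t i b) (A.evalUpdate h' t i b) := by
  refine (hA.isOp_rootOp t).mono fun j => ?_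
  rcases eq_or_ne j i with rfl | hj
  · simpa using SLe.refl _ _
  · have := (hside j hj).opp
    rw [childSign_opp, Sgn.opp_opp] at this
    simpa [hj] using hA.eval_mono hle this

theorem isParamFilter_residual (hA : A.IsLatticeExpansion)
    (hside : ∀ j ≠ i, Agrees (fun p => (ε p).opp) (childSign t.rootSign.opp t j) (t.child j))
    (hR : IsParamFilter ε t.rootSign.opp R) :
    IsParamFilter ε (childSign t.rootSign.opp t i) (residual A t i R) := by
  have hop := hA.isOp_rootOp t
  refine ⟨fun h => ⟨.inl rfl, ?_, ?_⟩, ?_⟩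
  · rintro b b' (rfl | hb) (rfl | hb')
    · exact .inl (sTop_smeet _ _)
    · rw [sTop_smeet]; exact .inr hb'
    · rw [smeet_sTop]; exact .inr hb
    · refine .inr ?_
      rw [Ops.evalUpdate, childSign_opp, hop]
      exact (hR.isSFilter h).smeet_mem hb hb'
  · rintro b b' hbb (rfl | hb)
    · exact .inl ((sLe_sTop _ _).antisymm hbb)
    · refine .inr ((hR.isSFilter h).mem_of_le (sLe_opp.2 (hop.mono_update _ _ ?_)) hb)
      rwa [childSign_opp, sLe_opp] at hbb
  · rintro h h' hle b (rfl | hb)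
    · exact .inl rfl
    · exact .inr ((hR.isSFilter h).mem_of_le (sLe_opp.2 (hA.evalUpdate_mono hside hle b))
        (hR.anti hle hb))

theorem dependsOn_residual {D : Set ℕ} (hside : ∀ j ≠ i, (t.child j).vars ⊆ D)
    (hR : DependsOn R D) : DependsOn (residual A t i R) D := by
  intro h h' hh
  have : ∀ b, A.evalUpdate h t i b = A.evalUpdate h' t i b := by
    intro b
    refine congrArg _ (funext fun j => ?_)
    rcases eq_or_ne j i with rfl | hj
    · simp
    · simpa [hj] using A.dependsOn_eval (t.child j) fun k hk => hh k (hside j hj hk)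
  simp only [residual, this, hR hh]

/-- Residuation: a lower bound for `t` can be met in `L`, near any closed valuation, with an
approximation of any closed element below the argument `i`. -/
theorem exists_evalUpdate_mem (hA : A.IsLatticeExpansion) (ht : ∀ p, t ≠ .var p)
    (hside : ∀ j ≠ i, Agrees (fun p => (ε p).opp) (childSign t.rootSign.opp t j) (t.child j))
    (hR : IsParamFilter ε t.rootSign.opp R) {x : ℕ → CanExt L} {V : ℕ → Set L}
    (hV : IsClosedBelow ε x V)
    (hx : SLe t.rootSign.opp (sElt t.rootSign.opp (limFilter R V)) (A.canExt.eval x t))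
    {P : Set L} (hP : IsSFilter (childSign t.rootSign t i) P)
    (hPx : SLe (childSign t.rootSign t i) (sElt (childSign t.rootSign t i) P)
      (A.canExt.eval x (t.child i))) :
    ∃ h, (∀ p, h p ∈ V p) ∧ ∃ b ∈ P, A.evalUpdate h t i b ∈ R h := by
  have hside' : ∀ j ≠ i, Agrees ε (childSign t.rootSign t j) (t.child j) := fun j hj => by
    have := (hside j hj).opp
    rwa [childSign_opp, Sgn.opp_opp] at this
  rw [sLe_opp, A.canExt.eval_eq_rootOp _ ht] at hx
  obtain ⟨a, ha, h, hh, haR⟩ := (hA.isExt_rootOp t _ _ (hR.limFilter hV.isSFilter)).1 hx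
    (fun j => if j = i then P else limEval A (childSign t.rootSign t j) (t.child j) V)
    (fun j => by
      by_cases hj : j = i
      · subst hj; simpa using hP
      · simpa [hj] using isSFilter_limEval hA (hside' j hj) hV.isSFilter)
    (fun j => by
      by_cases hj : j = i
      · subst hj; simpa using hPx
      · simpa [hj] using sElt_limEval_le_of_isClosedBelow hA hV (hside' j hj))
  have hj : ∀ j, ∃ h : ℕ → L, (∀ p, h p ∈ V p) ∧
      (j ≠ i → SLe (childSign t.rootSign t j) (A.eval h (t.child j)) (a j)) := by
    intro j
    by_cases hj : j = i
    · exact ⟨h, hh, fun hj' => absurd hj hj'⟩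
    · have := ha j
      simp only [hj, if_false] at this
      obtain ⟨h, hh, hle⟩ := this
      exact ⟨h, hh, fun _ => hle⟩
  choose k hk hka using hj
  obtain ⟨k', hk', hle⟩ := exists_vLe_of_finite hV.isSFilter k hk
  obtain ⟨l, hl, h1, h2⟩ := exists_vLe_vLe hV.isSFilter hh hk'
  refine ⟨l, hl, a i, by simpa using ha i, (hR.isSFilter l).mem_of_le (sLe_opp.2 ?_)
    (hR.anti h1 haR)⟩
  refine (hA.isOp_rootOp t).mono fun j => ?_
  rcases eq_or_ne j i with rfl | hj
  · simpa using SLe.refl _ _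
  · have h3 : VLe ε l (k j) := fun p => (h2 p).trans (hle j p)
    simpa [hj] using (hA.eval_mono h3 (hside' j hj)).trans (hka j hj)

theorem sElt_limFilter_residual_le (hA : A.IsLatticeExpansion) (ht : ∀ p, t ≠ .var p)
    (hside : ∀ j ≠ i, Agrees (fun p => (ε p).opp) (childSign t.rootSign.opp t j) (t.child j))
    (hR : IsParamFilter ε t.rootSign.opp R) {x : ℕ → CanExt L} {V : ℕ → Set L}
    (hV : IsClosedBelow ε x V)
    (hx : SLe t.rootSign.opp (sElt t.rootSign.opp (limFilter R V)) (A.canExt.eval x t)) :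
    SLe (childSign t.rootSign.opp t i)
      (sElt (childSign t.rootSign.opp t i) (limFilter (residual A t i R) V))
      (A.canExt.eval x (t.child i)) := by
  have hres := (isParamFilter_residual hA hside hR).limFilter hV.isSFilter
  rw [childSign_opp] at hres ⊢
  rw [sLe_opp, sLe_sElt_opp_iff hres]
  intro P hP hPx
  obtain ⟨h, hh, b, hb, hbR⟩ := exists_evalUpdate_mem hA ht hside hR hV hx hP hPx
  exact ⟨b, hb, h, hh, .inr hbR⟩

theorem Demand.evalUpdate_sTop (hA : A.IsLatticeExpansion) (ht : ∀ p, t ≠ .var p)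
    (hside : ∀ j ≠ i, Agrees (fun p => (ε p).opp) (childSign t.rootSign.opp t j) (t.child j))
    (hR : IsParamFilter ε t.rootSign.opp R) {x : ℕ → CanExt L}
    (hx : ∀ V, IsClosedBelow ε x V →
      SLe t.rootSign.opp (sElt t.rootSign.opp (limFilter R V)) (A.canExt.eval x t)) :
    Demand Ω ε x {h | A.evalUpdate h t i (sTop (childSign t.rootSign.opp t i)) ∈ R h} := by
  refine .near _ (fun h h' hle hh' => ?_) fun V hV => ?_
  · exact (hR.isSFilter h).mem_of_le (sLe_opp.2 (hA.evalUpdate_mono hside hle _))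
      (hR.anti hle hh')
  · obtain ⟨h, hh, b, -, hbR⟩ := exists_evalUpdate_mem hA ht hside hR hV (hx V hV)
      (isSFilter_univ _) (sElt_univ_le _ _)
    refine ⟨h, hh, (hR.isSFilter h).mem_of_le
      (sLe_opp.2 ((hA.isOp_rootOp t).mono_update _ _ (sLe_opp.1 ?_))) hbR⟩
    rw [childSign_opp]
    exact sLe_sTop _ _

theorem Ops.evalUpdate_eval (h : ℕ → L) (ht : ∀ p, t ≠ .var p) (i : Fin t.arity) :
    A.evalUpdate h t i (A.eval h (t.child i)) = A.eval h t := by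
  rw [Ops.evalUpdate, Function.update_eq_self, A.eval_eq_rootOp _ ht]

/-- The conditions on the nodes of a critical branch that ends in the variable `p`, in case it has
no Skeleton part. -/
def IsPIANode (Ω : ℕ → ℕ → Prop) (ε : ℕ → Sgn) (p : ℕ) (N : BranchNode S) : Prop :=
  IsPIA N.sign N.term ∧ (IsSRR N.sign N.term → ∀ j ≠ N.idx,
    Agrees (fun q => (ε q).opp) (childSign N.sign N.term j) (N.term.child j) ∧
      ∀ k ∈ (N.term.child j).vars, Ω k p)

/-- A PIA node is a binary meet, or residuation applies to it: all arguments other than the one on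
the critical branch are uncritical. -/
theorem IsPIANode.cases {p : ℕ} {σ : Sgn} {t : Term S} {i : Fin t.arity}
    (h : IsPIANode Ω ε p ⟨σ, t, i⟩) :
    (σ = .pos ∧ ∃ s₁ s₂, t = .and s₁ s₂) ∨ (σ = .neg ∧ ∃ s₁ s₂, t = .or s₁ s₂) ∨
      (σ = t.rootSign.opp ∧ (∀ q, t ≠ .var q) ∧ (∀ s₁ s₂, t ≠ .and s₁ s₂ ∧ t ≠ .or s₁ s₂) ∧
        ∀ j ≠ i, Agrees (fun q => (ε q).opp) (childSign σ t j) (t.child j) ∧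
          ∀ k ∈ (t.child j).vars, Ω k p) := by
  obtain ⟨h1, h2⟩ := h
  have harity : t.arity = 1 → ∀ j : Fin t.arity, j ≠ i → False := fun h j hj =>
    hj (Fin.ext (by have := j.2; have := i.2; omega))
  cases t with
  | var q => exact i.elim0
  | bot => exact i.elim0
  | top => exact i.elim0
  | and s₁ s₂ =>
    cases σ
    · exact .inl ⟨rfl, s₁, s₂, rfl⟩
    · rcases h1 with h | h <;> exact h.elim
  | or s₁ s₂ =>
    cases σ
    · rcases h1 with h | h <;> exact h.elim
    · exact .inr (.inl ⟨rfl, s₁, s₂, rfl⟩)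
  | fapp f a =>
    cases σ
    · rcases h1 with h | h <;> exact h.elim
    · refine .inr (.inr ⟨rfl, by simp, by simp, fun j hj => ?_⟩)
      rcases h1 with h | h
      exacts [(harity h j hj).elim, h2 h j hj]
  | gapp g a =>
    cases σ
    · refine .inr (.inr ⟨rfl, by simp, by simp, fun j hj => ?_⟩)
      rcases h1 with h | h
      exacts [(harity h j hj).elim, h2 h j hj]
    · rcases h1 with h | h <;> exact h.elim

/-- A lower bound `R` for a PIA term `t` is transferred to `L` by finitely many demands: it is moved
along the critical branches by residuation, until it becomes a lower bound for a variable. -/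
theorem eventually_eval_mem (hA : A.IsLatticeExpansion) {x : ℕ → CanExt L} (t : Term S) :
    ∀ (σ : Sgn) (R : (ℕ → L) → Set L), IsParamFilter ε σ R →
      (∀ b : Branch σ t, b.Critical ε → (∀ N ∈ b.nodes, IsPIANode Ω ε b.leafVar N) ∧
        DependsOn R {q | Ω q b.leafVar}) →
      (∀ V, IsClosedBelow ε x V → SLe σ (sElt σ (limFilter R V)) (A.canExt.eval x t)) →
      ∀ᶠ h in demandFilter Ω ε x, A.eval h t ∈ R h := by
  induction t using Term.child_induction with
  | h t ih =>
    intro σ R hR hb hx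
    by_cases hcrit : ∃ b : Branch σ t, b.Critical ε
    · obtain ⟨b, hbc⟩ := hcrit
      have hchild : ∀ i (b' : Branch (childSign σ t i) (t.child i)), b'.Critical ε →
          (∀ N ∈ b'.nodes, IsPIANode Ω ε b'.leafVar N) ∧ DependsOn R {q | Ω q b'.leafVar} :=
        fun i b' hb' =>
          ⟨fun N hN => (hb (.step σ t i b') hb').1 N (List.mem_cons_of_mem _ hN),
            (hb (.step σ t i b') hb').2⟩
      cases b with
      | leaf _ p =>
        obtain rfl : σ = ε p := hbc
        exact (Demand.atVar p R hR (hb (.leaf _ p) rfl).2 hx).eventually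
      | step _ _ i b' =>
        rcases ((hb _ hbc).1 _ (List.mem_cons_self ..)).cases with
          ⟨rfl, s₁, s₂, rfl⟩ | ⟨rfl, s₁, s₂, rfl⟩ | ⟨rfl, ht, hbin, hside⟩
        · have h1 := ih (0 : Fin 2) _ R hR (hchild (0 : Fin 2))
            fun V hV => (hx V hV).trans (smeet_le_left .pos _ _)
          have h2 := ih (1 : Fin 2) _ R hR (hchild (1 : Fin 2))
            fun V hV => (hx V hV).trans (smeet_le_right .pos _ _)
          filter_upwards [h1, h2] with h hh1 hh2
          exact (hR.isSFilter h).smeet_mem hh1 hh2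
        · have h1 := ih (0 : Fin 2) _ R hR (hchild (0 : Fin 2))
            fun V hV => (hx V hV).trans (smeet_le_left .neg _ _)
          have h2 := ih (1 : Fin 2) _ R hR (hchild (1 : Fin 2))
            fun V hV => (hx V hV).trans (smeet_le_right .neg _ _)
          filter_upwards [h1, h2] with h hh1 hh2
          exact (hR.isSFilter h).smeet_mem hh1 hh2
        · have hagr := fun j hj => (hside j hj).1
          have h1 := ih i _ (residual A t i R) (isParamFilter_residual hA hagr hR)
            (fun b'' hb'' => ⟨(hchild i b'' hb'').1, by
              refine dependsOn_residual (fun j hj k hk => ?_) (hchild i b'' hb'').2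
              -- the side condition, for the critical branch through `b''`
              rcases ((hb (.step _ t i b'') hb'').1 _ (List.mem_cons_self ..)).cases with
                ⟨h, s₁, s₂, rfl⟩ | ⟨h, s₁, s₂, rfl⟩ | ⟨-, -, -, hside'⟩
              · exact ((hbin s₁ s₂).1 rfl).elim
              · exact ((hbin s₁ s₂).2 rfl).elim
              · exact (hside' j hj).2 k hk⟩)
            fun V hV => sElt_limFilter_residual_le hA ht hagr hR hV (hx V hV)
          have h2 := (Demand.evalUpdate_sTop (Ω := Ω) hA ht hagr hR hx).eventually
          filter_upwards [h1, h2] with h hh1 hh2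
          rw [← A.evalUpdate_eval h ht i]
          rcases hh1 with hh1 | hh1
          exacts [hh1 ▸ hh2, hh1]
    · push Not at hcrit
      exact (Demand.of_uncritical hA (agrees_opp_iff.2 hcrit) hR hx).eventually

end PIA

/-! ### Skeleton terms and canonicity -/

section Skeleton

variable {S : Signature.{u, v}} {L : Type w} [Lattice L] [BoundedOrder L] {A : Ops S L}
  {Ω : ℕ → ℕ → Prop} {ε : ℕ → Sgn}

theorem IsSkeleton.eq_rootSign {σ : Sgn} {t : Term S} (h : IsSkeleton σ t) :
    σ = t.rootSign ∧ ∀ p, t ≠ .var p := by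
  rcases h with h | h <;> cases σ <;> cases t <;> first | exact h.elim | exact ⟨rfl, by simp⟩

theorem IsInductiveTree.child {σ : Sgn} {t : Term S} (h : IsInductiveTree Ω ε σ t)
    (i : Fin t.arity) : IsInductiveTree Ω ε (childSign σ t i) (t.child i) := by
  intro b hb
  obtain ⟨⟨P₂, P₁, heq, h2, h1⟩, hside⟩ := h (.step σ t i b) hb
  refine ⟨?_, fun N hN => hside N (List.mem_cons_of_mem _ hN)⟩
  change _ :: b.nodes = _ at heq
  cases P₂ with
  | nil => exact ⟨[], b.nodes, rfl, by simp,
      fun N hN => h1 N (by rw [← List.nil_append P₁, ← heq]; exact List.mem_cons_of_mem _ hN)⟩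
  | cons N P₂ =>
    exact ⟨P₂, P₁, (List.cons.inj heq).2, fun N hN => h2 N (List.mem_cons_of_mem _ hN), h1⟩

theorem IsInductiveTree.isPIANode {σ : Sgn} {t : Term S} (h : IsInductiveTree Ω ε σ t)
    (ht : ¬ (σ = t.rootSign ∧ ∀ p, t ≠ .var p)) (b : Branch σ t) (hb : b.Critical ε) :
    ∀ N ∈ b.nodes, IsPIANode Ω ε b.leafVar N := by
  obtain ⟨⟨P₂, P₁, heq, h2, h1⟩, hside⟩ := h b hb
  intro N hN
  refine ⟨?_, hside N hN⟩
  cases P₂ with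
  | nil => exact h1 N (by simpa [heq] using hN)
  | cons M P₂ =>
    cases b with
    | leaf => cases hN
    | step _ _ i b =>
      obtain rfl : _ = M := (List.cons.inj heq).1
      exact absurd (h2 _ (List.mem_cons_self ..)).eq_rootSign ht

/-- The value of an inductive signed term in the canonical extension is the join of the closed
elements that become lower bounds of its values in `L` by finitely many demands. -/
theorem sLe_sElt_of_forall_eventually (hA : A.IsLatticeExpansion) {x : ℕ → CanExt L} (t : Term S) :
    ∀ σ, IsInductiveTree Ω ε σ t → ∀ Q, IsSFilter σ.opp Q →
      (∀ P, IsSFilter σ P → (∀ᶠ h in demandFilter Ω ε x, A.eval h t ∈ P) → ∃ a ∈ P, a ∈ Q) →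
      SLe σ (A.canExt.eval x t) (sElt σ.opp Q) := by
  induction t using Term.child_induction with
  | h t ih =>
    intro σ hσ Q hQ hPQ
    by_cases ht : σ = t.rootSign ∧ ∀ p, t ≠ .var p
    · obtain ⟨rfl, ht⟩ := ht
      have hop := hA.isOp_rootOp t
      rw [A.canExt.eval_eq_rootOp _ ht]
      refine (hA.isExt_rootOp t).le_of_dense hop
        (fun i => {P | IsSFilter (childSign t.rootSign t i) P ∧
          ∀ᶠ h in demandFilter Ω ε x, A.eval h (t.child i) ∈ P})
        (fun i P hP => hP.1) (fun i => ⟨Set.univ, isSFilter_univ _, by simp⟩)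
        (fun i Q hQ hPQ => ih i _ (hσ.child i) Q hQ fun P hP hev => hPQ P ⟨hP, hev⟩) hQ ?_
      intro P hP
      obtain ⟨b, ⟨a, ha, hab⟩, hb⟩ := hPQ _ (isSFilter_image hop fun i => (hP i).1) (by
        filter_upwards [Filter.eventually_all.2 fun i => (hP i).2] with h hh
        exact ⟨_, hh, by rw [A.eval_eq_rootOp _ ht]; exact .refl _ _⟩)
      exact ⟨a, ha, hQ.mem_of_le (sLe_opp.2 hab) hb⟩
    · refine (sLe_sElt_opp_iff hQ).2 fun P hP hPx => hPQ P hP ?_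
      refine eventually_eval_mem hA t σ (fun _ => P) ⟨fun _ => hP, fun _ => subset_rfl⟩
        (fun b hb => ⟨hσ.isPIANode ht b hb, fun _ _ _ => rfl⟩) fun V hV => ?_
      have : limFilter (fun _ => P) V = P := by
        ext a
        exact ⟨fun ⟨_, _, ha⟩ => ha,
          fun ha => ⟨fun p => sTop (ε p), fun p => (hV.isSFilter p).top_mem, ha⟩⟩
      rwa [this]

theorem IsInductive.constructivelyCanonical {s t : Term S} (hst : IsInductive s t) :
    ConstructivelyCanonical.{u, v, w} s t := by
  obtain ⟨Ω, ε, hirr, htr, hs, ht⟩ := hst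
  intro L _ _ A hA hval x
  refine sLe_of_forall_le_sElt (σ := .pos) fun Q hQ htQ => ?_
  refine sLe_sElt_of_forall_eventually hA s .pos hs Q hQ fun P hP hevP => ?_
  have h1 : SLe .neg (A.canExt.eval x t) (sElt .pos P) := by
    refine sLe_sElt_of_forall_eventually hA t .neg ht P hP fun P' hP' hevP' => ?_
    have := demandFilter_neBot hirr htr (ε := ε) x
    obtain ⟨h, hh, hh'⟩ := (hevP.and hevP').exists
    exact ⟨_, hh', hP.mem_of_le (hval h) hh⟩
  exact (sElt_le_sElt_opp hP hQ).1 (SLe.trans (σ := .pos) h1 htQ)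

end Skeleton
end LatExp

theorem mainTheorem1 (S : LatExp.Signature.{u, v}) (s t : LatExp.Term S)
    (hst : LatExp.IsInductive s t) :
    LatExp.ConstructivelyCanonical.{u, v, w} s t :=
  hst.constructivelyCanonical
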